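/- **Definitions.** A relative $(\max,+)$-function of $n$ variables is a function $\varphi(x)=\max_k(\alpha_k+a_k\cdot x)-\max_l(\beta_l+b_l\cdot x)$ given with this presentation (finite non-empty maxima, $\alpha_k,\beta_l\in\mathbb R$, $a_k,b_l\in\mathbb Q^n$). The corresponding relatively elementary function is $f_t(z)=\sum_k t^{\alpha_k}z^{a_k}\big/\sum_l t^{\beta_l}z^{b_l}$ for $t>1$ and $z\in(0,\infty)^n$. The state system of a pair $(f_t,g_t)$ of such functions of two variables is $$z_i^{j+1}=f_t(w_i^j,z_i^j),\qquad w_{i+1}^j=g_t(w_i^j,z_i^j)\qquad(i,j\ge 0)$$ with initial values $(z_i^0)_i$ and $(w_0^j)_j$. Write $(x/y)^{\pm1}=\max(x/y,y/x)$. For finite $S,R\subset\mathbb Z$, $A\ge 1$ and $t>1$, let $N_A(t^S)$ be the set of sequences $(z_i)$ with $A^{-1}t^{k_i}\le z_i\le At^{k_i}$ for some $k_i\in S$, and let $N_A^{per}(t^R)$ be the set of sequences $(w^j)$ with $A^{-1}t^{q^j}\le w^j\le At^{q^j}$ for some periodic sequence $(q^j)$ in $R$, whose least period is denoted by $m$.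 The state system is *infinitely quasi-recursive* with respect to $(N_A(t^S),N^{per}_A(t^R))$ if for all $A\ge1$, $C>A$ and $C'\ge 1$ there is $t_0>1$ such that for all $t\ge t_0$ the following holds. For every $(w_0^j)_j\in N_A^{per}(t^R)$, with exponents of least period $m$, there is $p\ge1$, a multiple of $m$, such that 1. every solution with these $w_0^j$ and with $(z_i^0)_i\in N_A(t^S)$ satisfies $(z_i^{j+pl}/z_i^j)^{\pm1}\le C$ for all $i,j,l\ge0$; 2. for every $1\le p'\le p-1$ there are a solution with these $w_0^j$ and with $(z_i^0)_i\in N_A(t^S)$ and indices $i,j$ such that $(z_i^{j+pl+p'}/z_i^{j+pl})^{\pm1}\ge C'$ for all $l\ge0$; and if $p'$ is a multiple of $m$, there is such a solution for which, for all $j\ge0$, $(z_i^{j+p'}/z_i^j)^{\pm1}\ge C'$ for some $i$. Moreover, infinitely many values $p/m$ (in particular infinitely many $p$) occur in this way when $(w_0^j)_j$ runs through $N_A^{per}(t^R)$. A Mealy automaton with finite sets $Q$ of states and $S$ of letters is a pair of maps $\psi:Q\times S\to S$, $\phi:Q\times S\to Q$. A state $q$ acts on infinite words by $(k_i)\mapsto(\psi(q_i,k_i))$,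 where $q_0=q$, $q_{i+1}=\phi(q_i,k_i)$. If $Q,S\subset\mathbb Z$, a stable extension of the automaton is a pair of functions $\mathbb R^2\to\mathbb R$ that extend $\psi$ and $\phi$, each of which is stable: there are $0<\delta<1$ and $0\le\mu<1$ such that $|\varphi(x)-\varphi(x_0)|\le\mu\,|x-x_0|_\infty$ for all $x_0\in Q\times S$ and all $x\in\mathbb R^2$ with $|x-x_0|_\infty<\delta$. **Theorem 4.12.** There is a Mealy automaton with $8$ states and $2$ letters, and there are two of its states $u,v$, which act by bijections that generate an infinite torsion group, such that for every embedding of its set of states $Q$ and its alphabet $S$ into $\mathbb Z$ the automaton has a stable extension by relative $(\max,+)$-functions whose corresponding pair of relatively elementary functions $(f_t,g_t)$ has a state system that is infinitely quasi-recursive with respect to $(N_A(t^S),N^{per}_A(t^R))$, where $R=\{u,v\}\subset Q\subset\mathbb Z$. -/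

import Mathlib

noncomputable section

/-- A relative `(max,+)`-function of `n` variables, given by its presentation
`max_k (α_k + a_k · x) - max_l (β_l + b_l · x)` with real constants `α_k, β_l` and rational
slopes `a_k, b_l`; both maxima run over finite non-empty index sets. -/
structure RelMaxPlus (n : ℕ) where
  numTerms : ℕ
  denTerms : ℕ
  α : Fin (numTerms + 1) → ℝ
  a : Fin (numTerms + 1) → Fin n → ℚ
  β : Fin (denTerms + 1) → ℝ
  b : Fin (denTerms + 1) → Fin n → ℚ

namespace RelMaxPlus

/-- The piecewise linear function `ℝⁿ → ℝ` given by the presentation. -/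
def eval {n : ℕ} (φ : RelMaxPlus n) (x : Fin n → ℝ) : ℝ :=
  (Finset.univ.sup' Finset.univ_nonempty fun k => φ.α k + ∑ i, (φ.a k i : ℝ) * x i) -
    (Finset.univ.sup' Finset.univ_nonempty fun l => φ.β l + ∑ i, (φ.b l i : ℝ) * x i)

/-- The relatively elementary function `f_t` that corresponds to the presentation:
`f_t(z) = (∑_k t ^ α_k z ^ a_k) / (∑_l t ^ β_l z ^ b_l)` for `t > 1` and positive `z`. -/
def relElem {n : ℕ} (φ : RelMaxPlus n) (t : ℝ) (z : Fin n → ℝ) : ℝ :=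
  (∑ k, t ^ φ.α k * ∏ i, z i ^ (φ.a k i : ℝ)) / (∑ l, t ^ φ.β l * ∏ i, z i ^ (φ.b l i : ℝ))

end RelMaxPlus

/-- `(z, w)` is a solution of the state system of `(f, g)`:
`z_i^{j+1} = f (w_i^j, z_i^j, …, z_{i+α}^j)` and `w_{i+1}^j = g (w_i^j, z_i^j, …, z_{i+β}^j)`.
Here `z i j` stands for `z_i^j` and `w i j` for `w_i^j`; the initial values are `z i 0` and
`w 0 j`. -/
def IsStateSolution {α β : ℕ} (f : (Fin (α + 2) → ℝ) → ℝ) (g : (Fin (β + 2) → ℝ) → ℝ)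
    (z w : ℕ → ℕ → ℝ) : Prop :=
  (∀ i j, z i (j + 1) = f (Fin.cons (w i j) fun k : Fin (α + 1) => z (i + k) j)) ∧
    (∀ i j, w (i + 1) j = g (Fin.cons (w i j) fun k : Fin (β + 1) => z (i + k) j))

/-- `(x / y)^{±1}`, that is `max (x / y) (y / x)`. -/
def ratioPM (x y : ℝ) : ℝ := max (x / y) (y / x)

/-- The sequences `z` with `A⁻¹ t ^ {k_i} ≤ z_i ≤ A t ^ {k_i}` for all `i`. -/
def expNbhd (A t : ℝ) (k : ℕ → ℤ) : Set (ℕ → ℝ) :=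
  {z | ∀ i, A⁻¹ * t ^ k i ≤ z i ∧ z i ≤ A * t ^ k i}

/-- The exponential lattice `N_A(t^S)`. -/
def expLattice (A t : ℝ) (S : Set ℤ) : Set (ℕ → ℝ) :=
  {z | ∃ k : ℕ → ℤ, (∀ i, k i ∈ S) ∧ z ∈ expNbhd A t k}

/-- The part of the quasi-periodic exponential lattice `N_A^{per}(t^R)` whose exponent sequence
has least period `m`. The lattice `N_A^{per}(t^R)` is the union of these over all `m`. -/
def perExpLattice (A t : ℝ) (R : Set ℤ) (m : ℕ) : Set (ℕ → ℝ) :=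
  {w | ∃ q : ℕ → ℤ, (∀ j, q j ∈ R) ∧ IsLeast {n | 0 < n ∧ Function.Periodic q n} m ∧
    w ∈ expNbhd A t q}

/-- `p` is a quasi-period, with constants `C` and `C'`, of the state system of `(f, g)` with
initial set `X` and the fixed initial values `w₀`, where `m` is the period of the exponents of
`w₀`. The last two clauses say that no smaller `p'` is a quasi-period: the lower bound recurs in
every period, and if `p'` is a multiple of `m`, then it holds at all times `j`. -/
structure IsQuasiPeriod {α β : ℕ} (f : (Fin (α + 2) → ℝ) → ℝ) (g : (Fin (β + 2) → ℝ) → ℝ)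
    (X : Set (ℕ → ℝ)) (w₀ : ℕ → ℝ) (C C' : ℝ) (m p : ℕ) : Prop where
  pos : 0 < p
  dvd : m ∣ p
  upper : ∀ z w : ℕ → ℕ → ℝ, IsStateSolution f g z w → (fun i => z i 0) ∈ X → w 0 = w₀ →
    ∀ i j l, ratioPM (z i (j + p * l)) (z i j) ≤ C
  lower : ∀ p', 0 < p' → p' < p →
    ∃ z w : ℕ → ℕ → ℝ, IsStateSolution f g z w ∧ (fun i => z i 0) ∈ X ∧ w 0 = w₀ ∧
      ∃ i j, ∀ l, C' ≤ ratioPM (z i (j + p * l + p')) (z i (j + p * l))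
  lower_of_dvd : ∀ p', 0 < p' → p' < p → m ∣ p' →
    ∃ z w : ℕ → ℕ → ℝ, IsStateSolution f g z w ∧ (fun i => z i 0) ∈ X ∧ w 0 = w₀ ∧
      ∀ j, ∃ i, C' ≤ ratioPM (z i (j + p')) (z i j)

/-- The state system of `(f_t, g_t)` is infinitely quasi-recursive with respect to
`(N_A(t^S), N_A^{per}(t^R))`: every `w₀` in `N_A^{per}(t^R)` has a quasi-period `p`, and among the
numbers `p / m` of passes through the period of the input there are infinitely many (so there are
infinitely many `p`). The initial values are only known up to the factor `A`, so that `C > A`. -/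
def InfinitelyQuasiRecursive {α β : ℕ} (f : ℝ → (Fin (α + 2) → ℝ) → ℝ)
    (g : ℝ → (Fin (β + 2) → ℝ) → ℝ) (S R : Set ℤ) : Prop :=
  ∀ A C C' : ℝ, 1 ≤ A → A < C → 1 ≤ C' → ∃ t₀ : ℝ, 1 < t₀ ∧ ∀ t : ℝ, t₀ ≤ t →
    (∀ m : ℕ, ∀ w₀ ∈ perExpLattice A t R m,
      ∃ p, IsQuasiPeriod (f t) (g t) (expLattice A t S) w₀ C C' m p) ∧
    {r : ℕ | ∃ m : ℕ, ∃ w₀ ∈ perExpLattice A t R m,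
      IsQuasiPeriod (f t) (g t) (expLattice A t S) w₀ C C' m (m * r)}.Infinite

/-- A Mealy automaton with states `Q` and alphabet `S`. -/
structure MealyAutomaton (Q S : Type) where
  out : Q → S → S
  next : Q → S → Q

namespace MealyAutomaton

variable {Q S : Type}

/-- The states `q_0 = q`, `q_{i+1} = φ(q_i, k_i)` that the automaton runs through. -/
def stateSeq (M : MealyAutomaton Q S) (q : Q) (k : ℕ → S) : ℕ → Q
  | 0 => q
  | i + 1 => M.next (stateSeq M q k i) (k i)

/-- The map `A_q` on infinite words: `k'_i = ψ(q_i, k_i)`. -/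
def act (M : MealyAutomaton Q S) (q : Q) (k : ℕ → S) : ℕ → S :=
  fun i => M.out (M.stateSeq q k i) (k i)

/-- The states `u` and `v` act by bijections, which generate an infinite torsion group. -/
def GeneratesInfiniteTorsionGroup (M : MealyAutomaton Q S) (u v : Q) : Prop :=
  ∃ U V : Equiv.Perm (ℕ → S), ⇑U = M.act u ∧ ⇑V = M.act v ∧
    Infinite (Subgroup.closure {U, V}) ∧ IsMulTorsion (Subgroup.closure {U, V})

end MealyAutomaton

/-- `φ : ℝ × ℝ ^ n → ℝ` is stable with respect to `(Q, S)`. The distance is the one of the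
supremum norm. -/
def IsStable {n : ℕ} (Q S : Set ℝ) (φ : (Fin (n + 1) → ℝ) → ℝ) : Prop :=
  ∃ δ μ : ℝ, 0 < δ ∧ δ < 1 ∧ 0 ≤ μ ∧ μ < 1 ∧
    ∀ x p : Fin (n + 1) → ℝ, p 0 ∈ Q → (∀ i : Fin n, p i.succ ∈ S) → dist x p < δ →
      |φ x - φ p| ≤ μ * dist x p

/-- The relative `(max,+)`-functions `Ψ`, `Φ` (first variable: state, second variable: letter)
form a stable extension of the automaton, whose states and letters are embedded into the integers
by `eQ` and `eS`. -/
structure MealyAutomaton.IsStableExtension {Q S : Type} (M : MealyAutomaton Q S) (eQ : Q → ℤ)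
    (eS : S → ℤ) (Ψ Φ : RelMaxPlus 2) : Prop where
  out_eq : ∀ q s, Ψ.eval ![(eQ q : ℝ), (eS s : ℝ)] = (eS (M.out q s) : ℝ)
  next_eq : ∀ q s, Φ.eval ![(eQ q : ℝ), (eS s : ℝ)] = (eQ (M.next q s) : ℝ)
  stable_out : IsStable (n := 1) (Set.range fun q => (eQ q : ℝ)) (Set.range fun s => (eS s : ℝ))
    Ψ.eval
  stable_next : IsStable (n := 1) (Set.range fun q => (eQ q : ℝ)) (Set.range fun s => (eS s : ℝ))
    Φ.eval

end

/-!
The automaton contains the states of the automaton of the Grigorchuk group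
`Γ = ⟨a, b, c, d⟩`, where `a` exchanges the first letter and `b = (a, c)`, `c = (a, d)`,
`d = (1, b)`, together with `u = σ(1, a)`, its inverse and `v = (b, c)`.

*The group.* Every element of `⟨u, v⟩` is `(x, y)` or `a (x, y)` with `x, y ∈ Γ`, so that the
torsion of `⟨u, v⟩` follows from the torsion of `Γ` (`Grigorchuk.isTwoTorsion_of_mem_ball`), which
is proved by induction on the number of letters `a` in a word. Conversely `u² = (a, a)`, `v = (b, c)` and
`u⁻¹vu` show that the elements of `⟨u, v⟩` that fix the first letter act by all of `Γ` after the
letter `0`. Elements of `Γ` of large order are found with the substitution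
`a ↦ aca, b ↦ d, c ↦ b, d ↦ c`, which maps a word `w` to an element `(h(w), w)` where `h(w)` lies in
the dihedral group `⟨a, d⟩` of order `8`: if the sections `h` are trivial, then the substitution
moves the action of `w` one level down the tree, and a product with the involution `(ab)⁸` that
exchanges two vertices has twice the order of `w` (`Grigorchuk.evalWord_of_pow_double`).

*The stable extension.* For integral points `P` and values `v P` the difference of
`max_P (λ (2 P · x - |P|²) + v P)` and `max_P λ (2 P · x - |P|²)` equals `v P` near `P` when `λ` is
large, because there the same index attains both maxima, with a gap. For the same reason the
corresponding quotient of sums maps a neighbourhood of `t ^ P` of bounded width to the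
neighbourhood `D⁻¹ t ^ v P ≤ y ≤ D t ^ v P` with `D` arbitrarily close to `1`, for large `t`
(`exists_voronoi_relElem_mem`).

*The state system.* Hence solutions follow the action of the automaton with an error that does not
accumulate (`Contracts.isNear`): the exponents of `(z_i^j)_i` are the image of those of `(z_i^0)_i`
under the product of the first `j` states `u` or `v` in the exponents of `w_0`. If these have least
period `m`, then the quasi-period is `m` times the order of the product along one period
(`Contracts.isQuasiPeriod`). As `u ≠ v`, no smaller number can be one. Every element of the
torsion group `⟨u, v⟩` is a positive word, hence a power of the product along the least period of
some sequence, and so the quotients `p / m` are unbounded.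
-/

/-! ### Words and the binary rooted tree -/

/-- Infinite words in the letters `0` and `1`. -/
abbrev BinWord : Type := ℕ → Fin 2

namespace BinWord

/-- The word `x s₀ s₁ s₂ …`. -/
def cons (x : Fin 2) (s : BinWord) : BinWord
  | 0 => x
  | n + 1 => s n

/-- The word without its first letter. -/
def tail (s : BinWord) : BinWord := fun n => s (n + 1)

@[simp] theorem cons_zero (x : Fin 2) (s : BinWord) : cons x s 0 = x := rfl

@[simp] theorem cons_succ (x : Fin 2) (s : BinWord) (n : ℕ) : cons x s (n + 1) = s n := rfl

@[simp] theorem tail_cons (x : Fin 2) (s : BinWord) : tail (cons x s) = s := rfl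

@[simp] theorem cons_head_tail (s : BinWord) : cons (s 0) (tail s) = s := by
  funext n
  cases n <;> rfl

theorem exists_eq_cons (s : BinWord) : ∃ x r, s = cons x r := ⟨s 0, tail s, by simp⟩

end BinWord

open BinWord

/-- The permutation of infinite words that fixes the first letter and acts on the rest of the
word by `p.1` after the letter `0` and by `p.2` after the letter `1`. -/
def level : Equiv.Perm BinWord × Equiv.Perm BinWord →* Equiv.Perm BinWord where
  toFun p :=
    { toFun := fun s => cons (s 0) ((if s 0 = 0 then p.1 else p.2) (tail s))
      invFun := fun s => cons (s 0) ((if s 0 = 0 then p.1.symm else p.2.symm) (tail s))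
      left_inv := fun s => by
        by_cases h : s 0 = 0
        · simp [h]
          simpa [h] using cons_head_tail s
        · simp [h]
      right_inv := fun s => by
        by_cases h : s 0 = 0
        · simp [h]
          simpa [h] using cons_head_tail s
        · simp [h] }
  map_one' := by
    ext1 s
    simp
  map_mul' p q := by
    ext1 s
    by_cases h : s 0 = 0 <;> simp [h]

@[simp] theorem level_cons_zero (p : Equiv.Perm BinWord × Equiv.Perm BinWord) (s : BinWord) :
    level p (cons 0 s) = cons 0 (p.1 s) := rfl

@[simp] theorem level_cons_one (p : Equiv.Perm BinWord × Equiv.Perm BinWord) (s : BinWord) :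
    level p (cons 1 s) = cons 1 (p.2 s) := rfl

theorem ext_cons {f g : Equiv.Perm BinWord} (h0 : ∀ s, f (cons 0 s) = g (cons 0 s))
    (h1 : ∀ s, f (cons 1 s) = g (cons 1 s)) : f = g := by
  ext1 s
  obtain ⟨x, r, rfl⟩ := exists_eq_cons s
  fin_cases x
  · exact h0 r
  · exact h1 r

theorem cons_inj {x : Fin 2} {r s : BinWord} (h : cons x r = cons x s) : r = s :=
  congrArg tail h

theorem level_injective : Function.Injective level := by
  rintro ⟨f, g⟩ ⟨f', g'⟩ h
  have h0 : f = f' := by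
    ext1 s
    exact cons_inj (x := 0) (by simpa using congrArg (fun e => e (cons 0 s)) h)
  have h1 : g = g' := by
    ext1 s
    exact cons_inj (x := 1) (by simpa using congrArg (fun e => e (cons 1 s)) h)
  rw [h0, h1]

theorem level_mul (f g f' g' : Equiv.Perm BinWord) :
    level (f, g) * level (f', g') = level (f * f', g * g') := (map_mul level _ _).symm

theorem level_pow (f g : Equiv.Perm BinWord) (n : ℕ) :
    level (f, g) ^ n = level (f ^ n, g ^ n) := (map_pow level _ _).symm

theorem level_one_one : level (1, 1) = 1 := map_one level

theorem level_eq_one {f g : Equiv.Perm BinWord} : level (f, g) = 1 ↔ f = 1 ∧ g = 1 :=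
  (level_injective.eq_iff' (map_one level)).trans Prod.mk_eq_one

/-! ### The automaton -/

/-- The automaton: the states `0, …, 4` are the identity and the generators `a, b, c, d` of the
Grigorchuk group, `5` and `6` are `u = σ(1, a)` and its inverse, and `7` is `v = (b, c)`. Here
`(g, h)` acts by `g` after the letter `0` and by `h` after the letter `1`, and `σ` exchanges the
first letter. -/
def burnsideAutomaton : MealyAutomaton (Fin 8) (Fin 2) where
  out q x := if q = 1 ∨ q = 5 ∨ q = 6 then 1 - x else x
  next q x :=
    (![![0, 0], ![0, 0], ![1, 3], ![1, 4], ![0, 2], ![0, 1], ![1, 0], ![2, 3]] :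
      Fin 8 → Fin 2 → Fin 8) q x

namespace burnsideAutomaton

/-- The state that acts by the inverse: `u` and `u⁻¹` are exchanged, all others are involutions. -/
def invState : Fin 8 → Fin 8 := ![0, 1, 2, 3, 4, 6, 5, 7]

theorem act_cons (q : Fin 8) (x : Fin 2) (s : BinWord) :
    burnsideAutomaton.act q (cons x s) =
      cons (burnsideAutomaton.out q x)
        (burnsideAutomaton.act (burnsideAutomaton.next q x) s) := by
  have key : ∀ n, burnsideAutomaton.stateSeq q (cons x s) (n + 1) =
      burnsideAutomaton.stateSeq (burnsideAutomaton.next q x) s n := by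
    intro n
    induction n with
    | zero => rfl
    | succ n ih =>
      rw [MealyAutomaton.stateSeq, ih]
      rfl
  funext n
  cases n with
  | zero => rfl
  | succ n =>
    change burnsideAutomaton.out (burnsideAutomaton.stateSeq q (cons x s) (n + 1)) (s n) = _
    rw [key]
    rfl

theorem out_invState :
    ∀ q x, burnsideAutomaton.out (invState q) (burnsideAutomaton.out q x) = x := by
  decide

theorem next_invState : ∀ q x,
    burnsideAutomaton.next (invState q) (burnsideAutomaton.out q x) =
      invState (burnsideAutomaton.next q x) := by
  decide

theorem invState_invState : ∀ q, invState (invState q) = q := by decide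

theorem act_invState_act (q : Fin 8) (s : BinWord) :
    burnsideAutomaton.act (invState q) (burnsideAutomaton.act q s) = s := by
  funext n
  induction n generalizing q s with
  | zero =>
    obtain ⟨x, r, rfl⟩ := exists_eq_cons s
    rw [act_cons, act_cons, cons_zero, cons_zero, out_invState]
  | succ n ih =>
    obtain ⟨x, r, rfl⟩ := exists_eq_cons s
    rw [act_cons, act_cons, cons_succ, cons_succ, next_invState, ih]

/-- The permutation by which a state acts. -/
def perm (q : Fin 8) : Equiv.Perm BinWord where
  toFun := burnsideAutomaton.act q
  invFun := burnsideAutomaton.act (invState q)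
  left_inv := act_invState_act q
  right_inv s := by simpa [invState_invState] using act_invState_act (invState q) s

theorem perm_cons (q : Fin 8) (x : Fin 2) (s : BinWord) :
    perm q (cons x s) = cons (burnsideAutomaton.out q x)
      (perm (burnsideAutomaton.next q x) s) := act_cons q x s

theorem perm_invState (q : Fin 8) : perm (invState q) = (perm q)⁻¹ := by
  rw [eq_inv_iff_mul_eq_one]
  ext1 s
  exact act_invState_act q s

theorem perm_zero : perm 0 = 1 := by
  ext1 s
  funext n
  induction n generalizing s with
  | zero =>
    obtain ⟨x, r, rfl⟩ := exists_eq_cons s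
    rw [perm_cons]
    rfl
  | succ n ih =>
    obtain ⟨x, r, rfl⟩ := exists_eq_cons s
    rw [perm_cons, cons_succ]
    have : burnsideAutomaton.next 0 x = 0 := by fin_cases x <;> rfl
    rw [this, ih]
    rfl

end burnsideAutomaton

open burnsideAutomaton

/-! ### The Grigorchuk group -/

namespace Grigorchuk

/-- The generator `a`, which exchanges the first letter. -/
def a : Equiv.Perm BinWord := perm 1

/-- The generator `b = (a, c)`. -/
def b : Equiv.Perm BinWord := perm 2

/-- The generator `c = (a, d)`. -/
def c : Equiv.Perm BinWord := perm 3

/-- The generator `d = (1, b)`. -/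
def d : Equiv.Perm BinWord := perm 4

theorem perm_eq_level {q q₀ q₁ : Fin 8} (h0 : burnsideAutomaton.out q 0 = 0)
    (h1 : burnsideAutomaton.out q 1 = 1) (h0' : burnsideAutomaton.next q 0 = q₀)
    (h1' : burnsideAutomaton.next q 1 = q₁) : perm q = level (perm q₀, perm q₁) := by
  apply ext_cons <;> intro s <;> rw [perm_cons]
  · rw [h0, h0']; rfl
  · rw [h1, h1']; rfl

theorem b_eq : b = level (a, c) := perm_eq_level rfl rfl rfl rfl

theorem c_eq : c = level (a, d) := perm_eq_level rfl rfl rfl rfl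

theorem d_eq : d = level (1, b) := by
  rw [← perm_zero]
  exact perm_eq_level rfl rfl rfl rfl

theorem a_cons_zero (s : BinWord) : a (cons 0 s) = cons 1 s := by
  have h := perm_cons 1 0 s
  have h2 : burnsideAutomaton.next 1 0 = 0 := rfl
  rw [h2, perm_zero] at h
  exact h

theorem a_cons_one (s : BinWord) : a (cons 1 s) = cons 0 s := by
  have h := perm_cons 1 1 s
  have h2 : burnsideAutomaton.next 1 1 = 0 := rfl
  rw [h2, perm_zero] at h
  exact h

theorem perm_mul_self {q : Fin 8} (h : invState q = q) : perm q * perm q = 1 := by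
  nth_rewrite 1 [← h]
  rw [perm_invState, inv_mul_cancel]

theorem a_mul_a : a * a = 1 := perm_mul_self rfl

theorem b_mul_b : b * b = 1 := perm_mul_self rfl

theorem c_mul_c : c * c = 1 := perm_mul_self rfl

theorem d_mul_d : d * d = 1 := perm_mul_self rfl

theorem a_mul_level_mul_a (f g : Equiv.Perm BinWord) : a * level (f, g) * a = level (g, f) := by
  apply ext_cons <;> intro s <;> simp [a_cons_zero, a_cons_one]

theorem a_mul_level (f g : Equiv.Perm BinWord) : a * level (f, g) = level (g, f) * a := by
  rw [← a_mul_level_mul_a f g, mul_assoc, a_mul_a, mul_one]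

/-- The recursions `bc = (1, cd)`, `cd = (1, db)` and `db = (a, bc)` permute the three identities
cyclically, so that they are proved together, letter by letter. -/
theorem klein_relations : b * c = d ∧ c * d = b ∧ d * b = c := by
  have key : ∀ n : ℕ, ∀ s : BinWord, (b * c) s n = d s n ∧ (c * d) s n = b s n ∧
      (d * b) s n = c s n := by
    have hbc : b * c = level (1, c * d) := by
      nth_rewrite 1 [b_eq]
      nth_rewrite 2 [c_eq]
      rw [level_mul, a_mul_a]
    have hcd : c * d = level (a, d * b) := by
      nth_rewrite 1 [c_eq]
      nth_rewrite 2 [d_eq]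
      rw [level_mul, mul_one]
    have hdb : d * b = level (a, b * c) := by
      nth_rewrite 1 [d_eq]
      nth_rewrite 2 [b_eq]
      rw [level_mul, one_mul]
    intro n
    induction n with
    | zero =>
      intro s
      obtain ⟨x, r, rfl⟩ := exists_eq_cons s
      rw [hbc, hcd, hdb, b_eq, c_eq, d_eq]
      fin_cases x <;> exact ⟨rfl, rfl, rfl⟩
    | succ n ih =>
      intro s
      obtain ⟨x, r, rfl⟩ := exists_eq_cons s
      obtain ⟨h1, h2, h3⟩ := ih r
      have ev : ∀ {f g : Equiv.Perm BinWord}, f = g →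
          f (cons x r) (n + 1) = g (cons x r) (n + 1) := by
        rintro f _ rfl
        rfl
      refine ⟨(ev hbc).trans (.trans ?_ (ev d_eq).symm), (ev hcd).trans (.trans ?_ (ev b_eq).symm),
        (ev hdb).trans (.trans ?_ (ev c_eq).symm)⟩ <;> fin_cases x
      exacts [rfl, h2, rfl, h3, rfl, h1]
  exact ⟨Equiv.ext fun s => funext fun n => (key n s).1,
    Equiv.ext fun s => funext fun n => (key n s).2.1,
    Equiv.ext fun s => funext fun n => (key n s).2.2⟩

theorem b_mul_c : b * c = d := klein_relations.1

theorem c_mul_d : c * d = b := klein_relations.2.1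

theorem d_mul_b : d * b = c := klein_relations.2.2

theorem c_mul_b : c * b = d := by
  rw [← c_mul_d, ← mul_assoc, c_mul_c, one_mul]

theorem d_mul_c : d * c = b := by
  rw [← d_mul_b, ← mul_assoc, d_mul_d, one_mul]

theorem b_mul_d : b * d = c := by
  rw [← b_mul_c, ← mul_assoc, b_mul_b, one_mul]

theorem a_ne_one : a ≠ 1 := by
  intro h
  have := congrArg (fun e : Equiv.Perm BinWord => e (cons 0 fun _ => 0) 0) h
  rw [a_cons_zero] at this
  simp at this

theorem b_ne_one : b ≠ 1 := by
  rw [b_eq, Ne, level_eq_one]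
  exact fun h => a_ne_one h.1

/-! ### Torsion -/

/-- The element has finite order, a power of two. -/
def IsTwoTorsion (g : Equiv.Perm BinWord) : Prop := ∃ n : ℕ, g ^ 2 ^ n = 1

theorem isTwoTorsion_of_sq {g : Equiv.Perm BinWord} (h : IsTwoTorsion (g * g)) :
    IsTwoTorsion g := by
  obtain ⟨n, hn⟩ := h
  exact ⟨n + 1, by rw [pow_succ', pow_mul, pow_two, hn]⟩

theorem isTwoTorsion_level {f g : Equiv.Perm BinWord} (hf : IsTwoTorsion f)
    (hg : IsTwoTorsion g) : IsTwoTorsion (level (f, g)) := by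
  obtain ⟨m, hm⟩ := hf
  obtain ⟨n, hn⟩ := hg
  refine ⟨m + n, ?_⟩
  rw [level_pow, level_eq_one]
  constructor
  · rw [pow_add, pow_mul, hm, one_pow]
  · rw [pow_add, mul_comm, pow_mul, hn, one_pow]

theorem IsTwoTorsion.mul_comm {f g : Equiv.Perm BinWord} (h : IsTwoTorsion (f * g)) :
    IsTwoTorsion (g * f) := by
  obtain ⟨n, hn⟩ := h
  refine ⟨n, ?_⟩
  have : g * f = g * (f * g) * g⁻¹ := by group
  rw [this, conj_pow, hn, mul_one, mul_inv_cancel]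

/-- The elements `1, b, c, d` of the Klein four-group, numbered by `0, 1, 2, 3`. -/
def klein : Fin 4 → Equiv.Perm BinWord := ![1, b, c, d]

/-- `true` for the letters `b` and `c`, whose section at `0` is `a`. -/
def hasA : Fin 4 → Bool := ![false, true, true, false]

/-- The section at the letter `1`, which permutes `b, c, d` cyclically. -/
def rot : Fin 4 → Fin 4 := ![0, 2, 3, 1]

theorem klein_eq_level (x : Fin 4) :
    klein x = level (if hasA x then a else 1, klein (rot x)) := by
  fin_cases x
  · exact level_one_one.symm
  · exact b_eq
  · exact c_eq
  · exact d_eq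

theorem exists_klein_mul (x y : Fin 4) : ∃ z, klein x * klein y = klein z := by
  fin_cases x <;> fin_cases y <;> simp only [klein] <;> simp [b_mul_b, c_mul_c, d_mul_d, b_mul_c,
    c_mul_b, b_mul_d, d_mul_b, c_mul_d, d_mul_c, Fin.exists_fin_succ]

theorem klein_mul_self (x : Fin 4) : klein x * klein x = 1 := by
  fin_cases x <;> simp [klein, b_mul_b, c_mul_c, d_mul_d]

/-- The element `a x₁ a x₂ ⋯ a xₖ`. -/
def alt (L : List (Fin 4)) : Equiv.Perm BinWord := (L.map fun x => a * klein x).prod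

@[simp] theorem alt_nil : alt [] = 1 := rfl

@[simp] theorem alt_cons (x : Fin 4) (L : List (Fin 4)) : alt (x :: L) = a * klein x * alt L := by
  simp [alt]

theorem alt_append (L L' : List (Fin 4)) : alt (L ++ L') = alt L * alt L' := by
  simp [alt]

theorem exists_alt_mul_klein (L : List (Fin 4)) (y : Fin 4) (hL : L ≠ []) :
    ∃ L' : List (Fin 4), L'.length = L.length ∧ alt L * klein y = alt L' := by
  obtain ⟨M, x, rfl⟩ := List.eq_nil_or_concat L |>.resolve_left hL
  obtain ⟨z, hz⟩ := exists_klein_mul x y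
  refine ⟨M ++ [z], by simp, ?_⟩
  simp [alt_append, mul_assoc, hz]

/-- The elements `x₀ a x₁ ⋯ a xₖ` of the Grigorchuk group with `k ≤ n`. -/
def ball (n : ℕ) : Set (Equiv.Perm BinWord) :=
  {g | ∃ x L, L.length ≤ n ∧ g = klein x * alt L}

theorem ball_mono {m n : ℕ} (h : m ≤ n) : ball m ⊆ ball n := by
  rintro _ ⟨x, L, hL, rfl⟩
  exact ⟨x, L, hL.trans h, rfl⟩

theorem klein_mem_ball (x : Fin 4) (n : ℕ) : klein x ∈ ball n := ⟨x, [], by simp, by simp⟩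

theorem a_mem_ball (n : ℕ) : a ∈ ball (n + 1) := ⟨0, [0], by simp, by simp [klein]⟩

theorem mul_mem_ball {m n : ℕ} {g h : Equiv.Perm BinWord} (hg : g ∈ ball m) (hh : h ∈ ball n) :
    g * h ∈ ball (m + n) := by
  obtain ⟨x, L, hL, rfl⟩ := hg
  obtain ⟨y, L', hL', rfl⟩ := hh
  by_cases h : L = []
  · obtain ⟨z, hz⟩ := exists_klein_mul x y
    exact ⟨z, L', by omega, by rw [← hz, h]; simp [mul_assoc]⟩
  · obtain ⟨M, hM, hM'⟩ := exists_alt_mul_klein L y h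
    refine ⟨x, M ++ L', by simp; omega, ?_⟩
    rw [alt_append, ← hM']
    simp only [mul_assoc]

mutual
/-- The first, third, fifth, … entries of a list. -/
def odds : List (Fin 4) → List (Fin 4)
  | [] => []
  | x :: L => x :: evens L
/-- The second, fourth, sixth, … entries of a list. -/
def evens : List (Fin 4) → List (Fin 4)
  | [] => []
  | _ :: L => odds L
end

theorem odds_evens_append (L M : List (Fin 4)) :
    (Even L.length → odds (L ++ M) = odds L ++ odds M ∧ evens (L ++ M) = evens L ++ evens M) ∧
    (Odd L.length → odds (L ++ M) = odds L ++ evens M ∧ evens (L ++ M) = evens L ++ odds M) := by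
  induction L with
  | nil => simp [odds, evens]
  | cons x L ih =>
    simp only [List.length_cons, List.cons_append, odds, evens, List.cons.injEq, true_and]
    constructor
    · intro h
      have := ih.2 (by grind)
      exact ⟨this.2, this.1⟩
    · intro h
      have := ih.1 (by grind)
      exact ⟨this.2, this.1⟩

theorem odds_evens_perm (L : List (Fin 4)) : (odds L ++ evens L).Perm L := by
  induction L with
  | nil => simp [odds, evens]
  | cons x L ih =>
    simp only [odds, evens, List.cons_append, List.perm_cons]
    exact List.perm_append_comm.trans ih

/-- The sections of an alternating word of even length: the number of letters `a` in them is the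
number of letters `b` and `c` at the even, respectively odd, places. -/
theorem exists_alt_eq_level (n : ℕ) : ∀ L : List (Fin 4), L.length = 2 * n →
    ∃ f ∈ ball ((evens L).countP hasA), ∃ g ∈ ball ((odds L).countP hasA),
      alt L = level (f, g) := by
  have hball : ∀ x, (if hasA x then a else 1) ∈ ball (if hasA x then 1 else 0) := by
    intro x
    split_ifs
    · exact a_mem_ball 0
    · exact klein_mem_ball 0 0
  induction n with
  | zero =>
    intro L hL
    obtain rfl : L = [] := by simpa using hL
    exact ⟨1, klein_mem_ball 0 _, 1, klein_mem_ball 0 _, level_one_one.symm⟩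
  | succ n ih =>
    rintro (_ | ⟨x, _ | ⟨y, L⟩⟩) hL
    · simp at hL
    · simp at hL; omega
    · obtain ⟨f, hf, g, hg, h⟩ := ih L (by simp at hL; omega)
      refine ⟨klein (rot x) * (if hasA y then a else 1) * f, ?_,
        (if hasA x then a else 1) * klein (rot y) * g, ?_, ?_⟩
      · have := mul_mem_ball (mul_mem_ball (klein_mem_ball (rot x) 0) (hball y)) hf
        refine ball_mono (le_of_eq ?_) this
        simp only [odds, evens, List.countP_cons]
        ring
      · have := mul_mem_ball (mul_mem_ball (hball x) (klein_mem_ball (rot y) 0)) hg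
        refine ball_mono (le_of_eq ?_) this
        simp only [odds, evens, List.countP_cons]
        ring
      · rw [alt_cons, alt_cons, h, klein_eq_level x, klein_eq_level y, ← mul_assoc, ← mul_assoc,
          a_mul_level_mul_a, level_mul, level_mul]

/-- If all letters are `b` or `c`, then both sections of an alternating word of even length are
alternating words as well, up to conjugation by `a`. -/
theorem alt_eq_level_of_hasA (n : ℕ) : ∀ L : List (Fin 4), L.length = 2 * n →
    (∀ x ∈ L, hasA x) →
      alt L = level (a * alt ((odds L).map rot) * a, alt ((evens L).map rot)) := by
  induction n with
  | zero =>
    intro L hL _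
    obtain rfl : L = [] := by simpa using hL
    simp [odds, evens, a_mul_a, level_one_one]
  | succ n ih =>
    rintro (_ | ⟨x, _ | ⟨y, L⟩⟩) hL hA
    · simp at hL
    · simp at hL; omega
    · have h := ih L (by simp at hL; omega) (fun z hz => hA z (by simp [hz]))
      have hx : hasA x := hA x (by simp)
      have hy : hasA y := hA y (by simp)
      rw [alt_cons, alt_cons, h, klein_eq_level x, klein_eq_level y, ← mul_assoc, ← mul_assoc,
        a_mul_level_mul_a, level_mul, level_mul]
      simp only [hx, hy, if_true, odds, evens, List.map_cons, alt_cons]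
      congr 2
      calc klein (rot x) * a * (a * alt ((odds L).map rot) * a)
          = klein (rot x) * (a * a) * alt ((odds L).map rot) * a := by simp only [mul_assoc]
        _ = (a * a) * klein (rot x) * alt ((odds L).map rot) * a := by simp [a_mul_a]
        _ = _ := by simp only [mul_assoc]

theorem isTwoTorsion_of_conj_a {g : Equiv.Perm BinWord} (h : IsTwoTorsion g) :
    IsTwoTorsion (a * g * a) := by
  apply IsTwoTorsion.mul_comm
  rwa [← mul_assoc, a_mul_a, one_mul]

/-- Every element of the Grigorchuk group has finite order, by induction on the number of letters
`a` in an alternating word. A word of even length `k` has sections with at most `k / 2` letters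
`a`. If `k` is odd, then the square has sections in which every letter `b` and `c` contributes one
letter `a`; this is less than `k` unless all letters are `b` or `c`. In that case the sections are
alternating words of length `k`, with `c, d` in place of `b, c`, so that after at most two more
steps there is a letter `d`. -/
theorem isTwoTorsion_of_mem_ball (n : ℕ) : ∀ g ∈ ball n, IsTwoTorsion g := by
  induction n using Nat.strong_induction_on with
  | _ n ih =>
  have sq_len : ∀ L : List (Fin 4), (L ++ L).length = 2 * L.length := by
    intro L; simp; ring
  -- an alternating word of length `n` of which the sections of the square are shorter
  have step : ∀ L : List (Fin 4), Odd L.length → L.length = n → (∃ x ∈ L, ¬ hasA x) →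
      IsTwoTorsion (alt L) := by
    intro L hodd hn ⟨x, hx, hxA⟩
    have hlt : L.countP hasA < n := by
      rw [← hn]
      refine lt_of_le_of_ne List.countP_le_length fun h => hxA ?_
      exact List.countP_eq_length.mp h x hx
    have hsum : (odds L).countP hasA + (evens L).countP hasA = L.countP hasA := by
      rw [← List.countP_append]
      exact (odds_evens_perm L).countP_eq _
    obtain ⟨f, hf, g, hg, h⟩ := exists_alt_eq_level L.length (L ++ L) (sq_len L)
    obtain ⟨ho, he⟩ := (odds_evens_append L L).2 hodd
    rw [he, List.countP_append] at hf
    rw [ho, List.countP_append] at hg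
    apply isTwoTorsion_of_sq
    rw [← alt_append, h]
    exact isTwoTorsion_level (ih _ (by omega) _ hf) (ih _ (by omega) _ hg)
  -- if all letters are `b` or `c`, then `rot` acts on the set of letters
  have reduce : ∀ L : List (Fin 4), Odd L.length → (∀ x ∈ L, hasA x) →
      (∀ L' : List (Fin 4), L'.length = L.length → (∀ y, y ∈ L' ↔ ∃ x ∈ L, rot x = y) →
        IsTwoTorsion (alt L')) → IsTwoTorsion (alt L) := by
    intro L hodd hA h
    have hp := odds_evens_perm L
    have hmem : ∀ y, (y ∈ odds L ∨ y ∈ evens L) ↔ y ∈ L := fun y => by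
      rw [← List.mem_append, hp.mem_iff]
    have hlen : (odds L).length + (evens L).length = L.length := by
      rw [← List.length_append, hp.length_eq]
    obtain ⟨ho, he⟩ := (odds_evens_append L L).2 hodd
    apply isTwoTorsion_of_sq
    rw [← alt_append, alt_eq_level_of_hasA L.length (L ++ L) (sq_len L)
      (fun x hx => hA x (by simpa using hx)), ho, he]
    refine isTwoTorsion_level (isTwoTorsion_of_conj_a (h _ ?_ ?_)) (h _ ?_ ?_)
    · simpa using hlen
    · intro y
      simp only [List.mem_map, List.mem_append, hmem]
    · simp only [List.length_map, List.length_append]; omega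
    · intro y
      simp only [List.mem_map, List.mem_append, or_comm (a := _ ∈ evens L), hmem]
  have odd_case : ∀ L : List (Fin 4), Odd L.length → L.length = n → IsTwoTorsion (alt L) := by
    have hrot2 : hasA (rot 2) = false := rfl
    have hrot1 : hasA (rot (rot 1)) = false := rfl
    have h12 : ∀ x, hasA x → x = 1 ∨ x = 2 := by decide
    intro L hodd hn
    by_cases hA : ∀ x ∈ L, hasA x
    · refine reduce L hodd hA fun L' hL' hmem' => ?_
      by_cases hA' : ∀ x ∈ L', hasA x
      · refine reduce L' (hL' ▸ hodd) hA' fun L'' hL'' hmem'' => ?_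
        refine step L'' (by rw [hL'', hL']; exact hodd) (by omega) ?_
        obtain ⟨x, hx⟩ : ∃ x, x ∈ L := by
          cases L with
          | nil => simp at hodd
          | cons x L => exact ⟨x, by simp⟩
        refine ⟨rot (rot x), (hmem'' _).2 ⟨rot x, (hmem' _).2 ⟨x, hx, rfl⟩, rfl⟩, ?_⟩
        rcases h12 x (hA x hx) with rfl | rfl
        · simp [hrot1]
        · have := hA' (rot 2) ((hmem' _).2 ⟨2, hx, rfl⟩)
          simp [hrot2] at this
      · push Not at hA'
        obtain ⟨x, hx, hxA⟩ := hA'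
        exact step L' (hL' ▸ hodd) (by omega) ⟨x, hx, hxA⟩
    · push Not at hA
      obtain ⟨x, hx, hxA⟩ := hA
      exact step L hodd hn ⟨x, hx, hxA⟩
  rintro g ⟨x, L, hL, rfl⟩
  rcases lt_or_eq_of_le hL with hlt | heq
  · exact ih _ hlt _ ⟨x, L, le_rfl, rfl⟩
  by_cases hnil : L = []
  · subst hnil
    exact ⟨1, by rw [alt_nil, mul_one, pow_one, pow_two, klein_mul_self]⟩
  apply IsTwoTorsion.mul_comm
  obtain ⟨M, hM, hM'⟩ := exists_alt_mul_klein L x hnil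
  rw [hM']
  rcases Nat.even_or_odd M.length with heven | hodd
  · obtain ⟨k, hk⟩ := heven
    have hpos : 0 < L.length := List.length_pos_iff.mpr hnil
    obtain ⟨f, hf, g, hg, h⟩ := exists_alt_eq_level k M (by omega)
    have hlen : ∀ K : List (Fin 4), ∀ j, K.length = 2 * j →
        (odds K).length = j ∧ (evens K).length = j := by
      intro K j
      induction j generalizing K with
      | zero =>
        intro hK
        obtain rfl : K = [] := by simpa using hK
        exact ⟨rfl, rfl⟩
      | succ j ihj =>
        rcases K with _ | ⟨y, _ | ⟨z, K⟩⟩ <;> intro hK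
        · simp at hK
        · simp at hK; omega
        · have := ihj K (by simp at hK; omega)
          simp [odds, evens, this.1, this.2]
    obtain ⟨ho, he⟩ := hlen M k (by omega)
    have h1 : (evens M).countP hasA ≤ _ := List.countP_le_length
    have h2 : (odds M).countP hasA ≤ _ := List.countP_le_length
    rw [h]
    exact isTwoTorsion_level (ih _ (by omega) _ hf) (ih _ (by omega) _ hg)
  · exact odd_case M hodd (by omega)

/-- The Grigorchuk group, generated by `a, b, c, d`. -/
def group : Subgroup (Equiv.Perm BinWord) := Subgroup.closure {a, b, c, d}

theorem isTwoTorsion_of_mem_group {g : Equiv.Perm BinWord} (hg : g ∈ group) :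
    IsTwoTorsion g := by
  have hgen : ∀ x ∈ ({a, b, c, d} : Set (Equiv.Perm BinWord)), x ∈ ball 1 := by
    rintro x (rfl | rfl | rfl | rfl)
    · exact a_mem_ball 0
    · exact klein_mem_ball 1 1
    · exact klein_mem_ball 2 1
    · exact klein_mem_ball 3 1
  have hinv : ∀ x ∈ ({a, b, c, d} : Set (Equiv.Perm BinWord)), x⁻¹ = x := by
    rintro x (rfl | rfl | rfl | rfl)
    · exact inv_eq_of_mul_eq_one_left a_mul_a
    · exact inv_eq_of_mul_eq_one_left b_mul_b
    · exact inv_eq_of_mul_eq_one_left c_mul_c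
    · exact inv_eq_of_mul_eq_one_left d_mul_d
  have : ∃ n, g ∈ ball n := by
    induction hg using Subgroup.closure_induction_left with
    | one => exact ⟨0, klein_mem_ball 0 0⟩
    | mul_left x hx y _ ih =>
      obtain ⟨n, hn⟩ := ih
      exact ⟨1 + n, mul_mem_ball (hgen x hx) hn⟩
    | inv_mul_cancel x hx y _ ih =>
      obtain ⟨n, hn⟩ := ih
      rw [hinv x hx]
      exact ⟨1 + n, mul_mem_ball (hgen x hx) hn⟩
  obtain ⟨n, hn⟩ := this
  exact isTwoTorsion_of_mem_ball n g hn

end Grigorchuk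

/-! ### Elements of large order -/

namespace Grigorchuk

/-- The evaluation at `a, b, c, d` of the elements of the free group on four generators. -/
def evalWord : FreeGroup (Fin 4) →* Equiv.Perm BinWord := FreeGroup.lift ![a, b, c, d]

/-- The Lysenok substitution `a ↦ aca`, `b ↦ d`, `c ↦ b`, `d ↦ c`. -/
def subst : FreeGroup (Fin 4) →* FreeGroup (Fin 4) :=
  FreeGroup.lift ![.of 0 * .of 2 * .of 0, .of 3, .of 1, .of 2]

/-- The section at the letter `0` of a word after the substitution. -/
def zeroSection : FreeGroup (Fin 4) →* Equiv.Perm BinWord := FreeGroup.lift ![d, 1, a, a]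

theorem evalWord_subst (w : FreeGroup (Fin 4)) :
    evalWord (subst w) = level (zeroSection w, evalWord w) := by
  have : evalWord.comp subst = level.comp (zeroSection.prod evalWord) := by
    ext1 i
    fin_cases i
    · simp only [MonoidHom.comp_apply, MonoidHom.prod_apply, subst, evalWord, zeroSection,
        FreeGroup.lift_apply_of]
      exact (congrArg (fun x => a * x * a) c_eq).trans (a_mul_level_mul_a a d)
    · simpa [subst, evalWord, zeroSection] using d_eq
    · simpa [subst, evalWord, zeroSection] using b_eq
    · simpa [subst, evalWord, zeroSection] using c_eq
  exact DFunLike.congr_fun this w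

/-- The group generated by `a` and `d` is the dihedral group of order `8`, of exponent `4`: its
elements are the products of a power of `a` and an element `(bᵐ, bⁿ)`. -/
theorem pow_four_eq_one {x : Equiv.Perm BinWord} (hx : x ∈ Subgroup.closure {a, d}) :
    x ^ 4 = 1 := by
  have key : ∃ m n : ℕ, x = level (b ^ m, b ^ n) ∨ x = a * level (b ^ m, b ^ n) := by
    have ha : ∀ y, (∃ m n : ℕ, y = level (b ^ m, b ^ n) ∨ y = a * level (b ^ m, b ^ n)) →
        ∃ m n : ℕ, a * y = level (b ^ m, b ^ n) ∨ a * y = a * level (b ^ m, b ^ n) := by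
      rintro y ⟨m, n, rfl | rfl⟩
      · exact ⟨m, n, .inr rfl⟩
      · exact ⟨m, n, .inl (by rw [← mul_assoc, a_mul_a, one_mul])⟩
    have hd : ∀ y, (∃ m n : ℕ, y = level (b ^ m, b ^ n) ∨ y = a * level (b ^ m, b ^ n)) →
        ∃ m n : ℕ, d * y = level (b ^ m, b ^ n) ∨ d * y = a * level (b ^ m, b ^ n) := by
      rintro y ⟨m, n, rfl | rfl⟩
      · exact ⟨m, n + 1, .inl (by rw [d_eq, level_mul, one_mul, pow_succ'])⟩
      · refine ⟨m + 1, n, .inr ?_⟩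
        rw [d_eq, a_mul_level, ← mul_assoc, level_mul, one_mul, ← pow_succ', a_mul_level]
    induction hx using Subgroup.closure_induction_left with
    | one => exact ⟨0, 0, .inl (by simp [level_one_one])⟩
    | mul_left x hx y _ ih =>
      rcases hx with rfl | rfl
      exacts [ha y ih, hd y ih]
    | inv_mul_cancel x hx y _ ih =>
      rcases hx with rfl | rfl
      · rw [inv_eq_of_mul_eq_one_left a_mul_a]; exact ha y ih
      · rw [inv_eq_of_mul_eq_one_left d_mul_d]; exact hd y ih
  have hb : ∀ n : ℕ, (b ^ n) ^ 2 = 1 := fun n => by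
    rw [← pow_mul, mul_comm, pow_mul, pow_two, b_mul_b, one_pow]
  obtain ⟨m, n, rfl | rfl⟩ := key
  · rw [pow_mul _ 2 2, level_pow, hb, hb, level_one_one, one_pow]
  · have : (a * level (b ^ m, b ^ n)) ^ 2 = level (b ^ (n + m), b ^ (m + n)) := by
      rw [pow_two, ← mul_assoc, a_mul_level_mul_a, level_mul, pow_add, pow_add]
    rw [pow_mul _ 2 2, this, level_pow, hb, hb, level_one_one]

theorem zeroSection_pow_four (w : FreeGroup (Fin 4)) : zeroSection w ^ 4 = 1 := by
  apply pow_four_eq_one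
  have ha : a ∈ Subgroup.closure {a, d} := Subgroup.subset_closure (.inl rfl)
  have hd : d ∈ Subgroup.closure {a, d} := Subgroup.subset_closure (.inr rfl)
  have hof : ∀ i, zeroSection (.of i) ∈ Subgroup.closure {a, d} := by
    intro i
    fin_cases i
    · exact (congrArg (· ∈ Subgroup.closure {a, d}) (FreeGroup.lift_apply_of ..)).mpr hd
    · exact (congrArg (· ∈ Subgroup.closure {a, d}) (FreeGroup.lift_apply_of ..)).mpr (one_mem _)
    · exact (congrArg (· ∈ Subgroup.closure {a, d}) (FreeGroup.lift_apply_of ..)).mpr ha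
    · exact (congrArg (· ∈ Subgroup.closure {a, d}) (FreeGroup.lift_apply_of ..)).mpr ha
  induction w using FreeGroup.induction_on with
  | C1 => exact one_mem _
  | of i => exact hof i
  | inv_of i _ => rw [_root_.map_inv]; exact inv_mem (hof i)
  | mul x y hx hy => rw [map_mul]; exact mul_mem hx hy

/-- The words of which all iterated substitutions have trivial section at `0`, so that the
substitution moves their action to the words that begin with `1`. -/
def branchWords : Subgroup (FreeGroup (Fin 4)) where
  carrier := {w | ∀ i, zeroSection (subst^[i] w) = 1}
  one_mem' i := by simp
  mul_mem' {w w'} hw hw' i := by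
    rw [iterate_map_mul, map_mul, hw, hw', one_mul]
  inv_mem' {w} hw i := by
    rw [iterate_map_inv, _root_.map_inv, hw, inv_one]

theorem subst_mem_branchWords {w : FreeGroup (Fin 4)} (hw : w ∈ branchWords) :
    subst w ∈ branchWords := fun i => by
  rw [← Function.iterate_succ_apply]
  exact hw (i + 1)

theorem pow_four_mem_branchWords (w : FreeGroup (Fin 4)) : w ^ 4 ∈ branchWords := fun i => by
  rw [iterate_map_pow, map_pow, zeroSection_pow_four]

theorem conj_mem_branchWords {w : FreeGroup (Fin 4)} (hw : w ∈ branchWords)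
    (x : FreeGroup (Fin 4)) : x * w * x⁻¹ ∈ branchWords := fun i => by
  simp only [iterate_map_mul, iterate_map_inv, map_mul, _root_.map_inv]
  rw [hw, mul_one, mul_inv_cancel]

theorem evalWord_subst_of_mem {w : FreeGroup (Fin 4)} (hw : w ∈ branchWords) :
    evalWord (subst w) = level (1, evalWord w) := by
  rw [evalWord_subst, show zeroSection w = 1 from hw 0]

/-- The word `(ab)⁸`, which acts by `b` after every word of length three. -/
def branchInvolution : FreeGroup (Fin 4) := ((.of 0 * .of 1) ^ 2) ^ 4

theorem evalWord_branchInvolution :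
    evalWord branchInvolution =
    level (level (level (b, b), level (b, b)), level (level (b, b), level (b, b))) := by
  have hab : (a * b) ^ 2 = level (c * a, a * c) := by
    have : (a * b) ^ 2 = a * b * a * b := by rw [pow_two]; simp only [mul_assoc]
    rw [this, b_eq, a_mul_level_mul_a, level_mul]
  have hca : (c * a) ^ 2 = level (a * d, d * a) := by
    have : (c * a) ^ 2 = c * (a * c * a) := by rw [pow_two]; simp only [mul_assoc]
    rw [this, c_eq, a_mul_level_mul_a, level_mul]
  have hac : (a * c) ^ 2 = level (d * a, a * d) := by
    have : (a * c) ^ 2 = a * c * a * c := by rw [pow_two]; simp only [mul_assoc]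
    rw [this, c_eq, a_mul_level_mul_a, level_mul]
  have had : (a * d) ^ 2 = level (b, b) := by
    have : (a * d) ^ 2 = a * d * a * d := by rw [pow_two]; simp only [mul_assoc]
    rw [this, d_eq, a_mul_level_mul_a, level_mul, mul_one, one_mul]
  have hda : (d * a) ^ 2 = level (b, b) := by
    have : (d * a) ^ 2 = d * (a * d * a) := by rw [pow_two]; simp only [mul_assoc]
    rw [this, d_eq, a_mul_level_mul_a, level_mul, mul_one, one_mul]
  have h : evalWord branchInvolution = ((a * b) ^ 2) ^ 4 := by
    rw [branchInvolution, map_pow, map_pow, map_mul]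
    rfl
  rw [h, hab, level_pow, pow_mul _ 2 2, pow_mul _ 2 2, hca, hac, level_pow, level_pow, had, hda]

/-- A word of which the order is twice the order of `w`: the action of `w` is moved to the words
that begin with `11101`, and `(ab)⁸` exchanges the prefixes `11101` and `11100`. -/
def double (w : FreeGroup (Fin 4)) : FreeGroup (Fin 4) :=
  branchInvolution * subst (subst (subst (.of 0 * subst (subst w) * (.of 0)⁻¹)))

theorem double_mem_branchWords {w : FreeGroup (Fin 4)} (hw : w ∈ branchWords) :
    double w ∈ branchWords :=
  mul_mem (pow_four_mem_branchWords _) (subst_mem_branchWords (subst_mem_branchWords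
    (subst_mem_branchWords (conj_mem_branchWords (subst_mem_branchWords
      (subst_mem_branchWords hw)) _))))

theorem evalWord_of_pow_double {w : FreeGroup (Fin 4)} (hw : w ∈ branchWords) {n : ℕ}
    (h : evalWord (double w) ^ (2 * n) = 1) : evalWord w ^ n = 1 := by
  have hw2 := subst_mem_branchWords hw
  have hw3 := conj_mem_branchWords (subst_mem_branchWords hw2) (.of 0)
  have hconj : evalWord (.of 0 * subst (subst w) * (.of 0)⁻¹) =
      level (level (1, evalWord w), 1) := by
    rw [map_mul, map_mul, _root_.map_inv, evalWord_subst_of_mem hw2, evalWord_subst_of_mem hw]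
    have ha : evalWord (.of 0) = a := FreeGroup.lift_apply_of ..
    rw [ha, inv_eq_of_mul_eq_one_left a_mul_a, a_mul_level_mul_a]
  have hsq : (a * level (1, evalWord w)) ^ 2 = level (evalWord w, evalWord w) := by
    rw [pow_two, ← mul_assoc, a_mul_level_mul_a, level_mul, mul_one, one_mul]
  rw [pow_mul, double, map_mul, evalWord_branchInvolution,
    evalWord_subst_of_mem (subst_mem_branchWords (subst_mem_branchWords hw3)),
    evalWord_subst_of_mem (subst_mem_branchWords hw3), evalWord_subst_of_mem hw3, hconj,
    level_mul, level_mul, level_mul] at h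
  have hb : b * level (level (1, evalWord w), 1) = level (a * level (1, evalWord w), c * 1) := by
    rw [b_eq, level_mul]
  rw [hb] at h
  simp only [level_pow, hsq, level_eq_one] at h
  exact h.2.2.2.1.1

/-- There are elements of order at least `2ⁿ⁺¹`, since all orders are powers of two. -/
theorem exists_pow_ne_one (n : ℕ) : ∃ w : FreeGroup (Fin 4), evalWord w ^ 2 ^ n ≠ 1 := by
  suffices ∃ w ∈ branchWords, evalWord w ^ 2 ^ n ≠ 1 from this.imp fun _ h => h.2
  induction n with
  | zero =>
    refine ⟨branchInvolution, pow_four_mem_branchWords _, ?_⟩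
    rw [evalWord_branchInvolution, pow_zero, pow_one, Ne, level_eq_one, level_eq_one,
      level_eq_one]
    exact fun h => b_ne_one h.1.1.1
  | succ n ih =>
    obtain ⟨w, hw, h⟩ := ih
    refine ⟨double w, double_mem_branchWords hw, fun h' => h ?_⟩
    rw [pow_succ'] at h'
    exact evalWord_of_pow_double hw h'

/-! ### The group generated by `u` and `v` -/

/-- The state `u = σ(1, a)`. -/
def u : Equiv.Perm BinWord := perm 5

/-- The state `v = (b, c)`. -/
def v : Equiv.Perm BinWord := perm 7

theorem v_eq : v = level (b, c) := perm_eq_level rfl rfl rfl rfl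

theorem u_eq : u = a * level (1, a) := by
  have h0 := perm_cons 5 0
  have h1 := perm_cons 5 1
  have h2 : burnsideAutomaton.next 5 0 = 0 := rfl
  rw [h2, perm_zero] at h0
  apply ext_cons <;> intro s
  · rw [Equiv.Perm.mul_apply, level_cons_zero, a_cons_zero]; exact h0 s
  · rw [Equiv.Perm.mul_apply, level_cons_one, a_cons_one]; exact h1 s

theorem u_sq : u * u = level (a, a) := by
  have : u * u = a * level (1, a) * a * level (1, a) := by rw [u_eq]; simp only [mul_assoc]
  rw [this, a_mul_level_mul_a, level_mul, mul_one, one_mul]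

theorem v_mul_v : v * v = 1 := perm_mul_self rfl

theorem u_pow_four : u * (u * (u * u)) = 1 := by
  have : u * (u * (u * u)) = (u * u) * (u * u) := by simp only [mul_assoc]
  rw [this, u_sq, level_mul, a_mul_a, level_one_one]

theorem u_ne_v : u ≠ v := by
  intro h
  have := congrArg (fun e : Equiv.Perm BinWord => e (cons 0 fun _ => 0) 0) h
  simp [u_eq, v_eq, a_cons_zero] at this

theorem generator_mem : a ∈ group ∧ b ∈ group ∧ c ∈ group ∧ d ∈ group := by
  refine ⟨?_, ?_, ?_, ?_⟩ <;> apply Subgroup.subset_closure <;> simp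

/-- The elements of the group generated by `u` and `v` lie in the wreath product of the Grigorchuk
group with the group of order two, so that their squares are pairs of torsion elements. -/
theorem isTwoTorsion_of_mem_closure {g : Equiv.Perm BinWord} (hg : g ∈ Subgroup.closure {u, v}) :
    IsTwoTorsion g := by
  obtain ⟨ha, hb, hc, -⟩ := generator_mem
  have key : ∃ x ∈ group, ∃ y ∈ group, g = level (x, y) ∨ g = a * level (x, y) := by
    have hu : ∀ g, (∃ x ∈ group, ∃ y ∈ group, g = level (x, y) ∨ g = a * level (x, y)) →
        ∃ x ∈ group, ∃ y ∈ group, u * g = level (x, y) ∨ u * g = a * level (x, y) := by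
      rintro g ⟨x, hx, y, hy, rfl | rfl⟩
      · refine ⟨x, hx, a * y, mul_mem ha hy, .inr ?_⟩
        rw [u_eq, mul_assoc, level_mul, one_mul]
      · refine ⟨a * x, mul_mem ha hx, y, hy, .inl ?_⟩
        rw [u_eq, ← mul_assoc, a_mul_level_mul_a, level_mul, one_mul]
    have hv : ∀ g, (∃ x ∈ group, ∃ y ∈ group, g = level (x, y) ∨ g = a * level (x, y)) →
        ∃ x ∈ group, ∃ y ∈ group, v * g = level (x, y) ∨ v * g = a * level (x, y) := by
      rintro g ⟨x, hx, y, hy, rfl | rfl⟩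
      · exact ⟨b * x, mul_mem hb hx, c * y, mul_mem hc hy, .inl (by rw [v_eq, level_mul])⟩
      · refine ⟨c * x, mul_mem hc hx, b * y, mul_mem hb hy, .inr ?_⟩
        rw [v_eq, a_mul_level, ← mul_assoc, level_mul, a_mul_level]
    induction hg using Subgroup.closure_induction_left with
    | one => exact ⟨1, one_mem _, 1, one_mem _, .inl level_one_one.symm⟩
    | mul_left x hx y _ ih =>
      rcases hx with rfl | rfl
      exacts [hu y ih, hv y ih]
    | inv_mul_cancel x hx y _ ih =>
      rcases hx with rfl | rfl
      · rw [inv_eq_of_mul_eq_one_right u_pow_four, mul_assoc, mul_assoc]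
        exact hu _ (hu _ (hu _ ih))
      · rw [inv_eq_of_mul_eq_one_left v_mul_v]
        exact hv y ih
  obtain ⟨x, hx, y, hy, rfl | rfl⟩ := key
  · exact isTwoTorsion_level (isTwoTorsion_of_mem_group hx) (isTwoTorsion_of_mem_group hy)
  · apply isTwoTorsion_of_sq
    rw [← mul_assoc, a_mul_level_mul_a, level_mul]
    exact isTwoTorsion_level (isTwoTorsion_of_mem_group (mul_mem hy hx))
      (isTwoTorsion_of_mem_group (mul_mem hx hy))

/-- The stabilizer of the first letter in the group generated by `u` and `v` acts after the letter
`0` by the whole Grigorchuk group: `u² = (a, a)`, `v = (b, c)` and `u⁻¹vu = (c, aba)`. -/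
theorem exists_level_mem_closure (w : FreeGroup (Fin 4)) :
    ∃ y, level (evalWord w, y) ∈ Subgroup.closure {u, v} := by
  have hu : u ∈ Subgroup.closure {u, v} := Subgroup.subset_closure (.inl rfl)
  have hv : v ∈ Subgroup.closure {u, v} := Subgroup.subset_closure (.inr rfl)
  have hu' : u⁻¹ = level (1, a) * a := by
    apply inv_eq_of_mul_eq_one_left
    rw [u_eq, mul_assoc, ← mul_assoc a a, a_mul_a, one_mul, level_mul, one_mul, a_mul_a,
      level_one_one]
  have ha : ∃ y, level (a, y) ∈ Subgroup.closure {u, v} := ⟨a, u_sq ▸ mul_mem hu hu⟩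
  have hb : ∃ y, level (b, y) ∈ Subgroup.closure {u, v} := ⟨c, v_eq ▸ hv⟩
  have hc : ∃ y, level (c, y) ∈ Subgroup.closure {u, v} := by
    refine ⟨a * b * a, ?_⟩
    have : level (c, a * b * a) = u⁻¹ * v * u := by
      have e : u⁻¹ * v * u = level (1, a) * (a * v * a) * level (1, a) := by
        rw [hu', u_eq]; simp only [mul_assoc]
      rw [e, v_eq, a_mul_level_mul_a, level_mul, level_mul, one_mul, mul_one]
    rw [this]
    exact mul_mem (mul_mem (inv_mem hu) hv) hu
  have hmul : ∀ {x x'}, (∃ y, level (x, y) ∈ Subgroup.closure {u, v}) →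
      (∃ y, level (x', y) ∈ Subgroup.closure {u, v}) →
      ∃ y, level (x * x', y) ∈ Subgroup.closure {u, v} := by
    rintro x x' ⟨y, hy⟩ ⟨y', hy'⟩
    exact ⟨y * y', level_mul .. ▸ mul_mem hy hy'⟩
  have hof : ∀ i, ∃ y, level (evalWord (.of i), y) ∈ Subgroup.closure {u, v} := by
    intro i
    rw [evalWord, FreeGroup.lift_apply_of]
    fin_cases i
    · exact ha
    · exact hb
    · exact hc
    · exact b_mul_c ▸ hmul hb hc
  induction w using FreeGroup.induction_on with
  | C1 => exact ⟨1, by rw [map_one, level_one_one]; exact one_mem _⟩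
  | of i => exact hof i
  | inv_of i _ =>
    obtain ⟨y, hy⟩ := hof i
    refine ⟨y⁻¹, ?_⟩
    rw [_root_.map_inv]
    have := inv_mem hy
    rwa [← _root_.map_inv level] at this
  | mul x y hx hy => rw [map_mul]; exact hmul hx hy

theorem exists_lt_orderOf (n : ℕ) : ∃ g ∈ Subgroup.closure {u, v}, n < orderOf g := by
  obtain ⟨w, hw⟩ := exists_pow_ne_one n
  obtain ⟨y, hy⟩ := exists_level_mem_closure w
  refine ⟨_, hy, ?_⟩
  obtain ⟨k, hk⟩ := isTwoTorsion_of_mem_closure hy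
  obtain ⟨j, -, hj⟩ := (Nat.dvd_prime_pow Nat.prime_two).mp (orderOf_dvd_of_pow_eq_one hk)
  have hnj : n < j := by
    by_contra hle
    have : level (evalWord w, y) ^ 2 ^ n = 1 :=
      orderOf_dvd_iff_pow_eq_one.mp (hj ▸ pow_dvd_pow 2 (not_lt.mp hle))
    rw [level_pow, level_eq_one] at this
    exact hw this.1
  rw [hj]
  exact hnj.trans Nat.lt_two_pow_self

end Grigorchuk

/-! ### Locally constant relative `(max,+)`-functions -/

open Filter Topology

/-- The squared Euclidean distance of the integral points `(p, s)` and `(p', s')`. -/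
def sqDist (P P' : ℤ × ℤ) : ℝ := ((P'.1 - P.1 : ℤ) : ℝ) ^ 2 + ((P'.2 - P.2 : ℤ) : ℝ) ^ 2

/-- A relative `(max,+)`-function which takes the value `v k` near the integral point `P k`. The
denominator is the convex function `max_k λ (2 P_k · x - |P_k|²)`, of which the domains of linearity
are the Voronoi cells of the points, and the numerator raises the `k`-th term by `v k`. -/
def voronoi {N : ℕ} (lam : ℤ) (P : Fin (N + 1) → ℤ × ℤ) (v : Fin (N + 1) → ℤ) : RelMaxPlus 2 where
  numTerms := N
  denTerms := N
  α k := v k - lam * ((P k).1 ^ 2 + (P k).2 ^ 2)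
  a k := ![2 * lam * (P k).1, 2 * lam * (P k).2]
  β k := -(lam * ((P k).1 ^ 2 + (P k).2 ^ 2))
  b k := ![2 * lam * (P k).1, 2 * lam * (P k).2]

section voronoi

variable {N : ℕ} {lam : ℤ} {P : Fin (N + 1) → ℤ × ℤ} {v : Fin (N + 1) → ℤ}

/-- The `k`-th affine function of the denominator of `voronoi lam P v`. -/
def voronoiTerm (lam : ℤ) (P : Fin (N + 1) → ℤ × ℤ) (k : Fin (N + 1)) (x : Fin 2 → ℝ) : ℝ :=
  lam * (2 * (P k).1 * x 0 + 2 * (P k).2 * x 1 - ((P k).1 ^ 2 + (P k).2 ^ 2))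

theorem one_le_sqDist (hP : Function.Injective P) {k l : Fin (N + 1)} (h : l ≠ k) :
    1 ≤ sqDist (P k) (P l) := by
  have hne : P l ≠ P k := fun e => h (hP e)
  have : (1 : ℤ) ≤ ((P l).1 - (P k).1) ^ 2 + ((P l).2 - (P k).2) ^ 2 := by
    by_contra hlt
    have h1 : ((P l).1 - (P k).1) ^ 2 = 0 := by
      nlinarith [sq_nonneg ((P l).1 - (P k).1), sq_nonneg ((P l).2 - (P k).2)]
    have h2 : ((P l).2 - (P k).2) ^ 2 = 0 := by
      nlinarith [sq_nonneg ((P l).1 - (P k).1), sq_nonneg ((P l).2 - (P k).2)]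
    apply hne
    ext
    · have := pow_eq_zero_iff (two_ne_zero) |>.1 h1; omega
    · have := pow_eq_zero_iff (two_ne_zero) |>.1 h2; omega
  unfold sqDist
  exact_mod_cast this

theorem abs_intCast_le_sq (n : ℤ) : |(n : ℝ)| ≤ (n : ℝ) ^ 2 := by
  have : |n| ≤ n ^ 2 := by
    rw [← sq_abs]
    rcases (abs_nonneg n).eq_or_lt with h | h
    · rw [← h]; simp
    · nlinarith
  exact_mod_cast this

/-- Near the point `P k` the `k`-th affine function exceeds the others by half of `λ` times the
squared distance of the points. -/
theorem voronoiTerm_le (hlam : 0 ≤ lam) (k l : Fin (N + 1)) {x : Fin 2 → ℝ}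
    (h0 : |x 0 - (P k).1| ≤ 1 / 4) (h1 : |x 1 - (P k).2| ≤ 1 / 4) :
    voronoiTerm lam P l x ≤ voronoiTerm lam P k x - lam / 2 * sqDist (P k) (P l) := by
  have hl : (0 : ℝ) ≤ lam := by exact_mod_cast hlam
  have e0 := abs_intCast_le_sq ((P l).1 - (P k).1)
  have e1 := abs_intCast_le_sq ((P l).2 - (P k).2)
  have m0 : (((P l).1 - (P k).1 : ℤ) : ℝ) * (x 0 - (P k).1) ≤
      (((P l).1 - (P k).1 : ℤ) : ℝ) ^ 2 * (1 / 4) :=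
    (le_abs_self _).trans (by rw [abs_mul]; exact mul_le_mul e0 h0 (abs_nonneg _) (sq_nonneg _))
  have m1 : (((P l).2 - (P k).2 : ℤ) : ℝ) * (x 1 - (P k).2) ≤
      (((P l).2 - (P k).2 : ℤ) : ℝ) ^ 2 * (1 / 4) :=
    (le_abs_self _).trans (by rw [abs_mul]; exact mul_le_mul e1 h1 (abs_nonneg _) (sq_nonneg _))
  unfold voronoiTerm sqDist
  push_cast at m0 m1 ⊢
  nlinarith [mul_le_mul_of_nonneg_left (add_le_add m0 m1) hl]

theorem voronoi_num (k : Fin (N + 1)) (x : Fin 2 → ℝ) :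
    (voronoi lam P v).α k + ∑ i, (((voronoi lam P v).a k i : ℚ) : ℝ) * x i =
      v k + voronoiTerm lam P k x := by
  simp [voronoi, voronoiTerm, Fin.sum_univ_two]
  ring

theorem voronoi_den (k : Fin (N + 1)) (x : Fin 2 → ℝ) :
    (voronoi lam P v).β k + ∑ i, (((voronoi lam P v).b k i : ℚ) : ℝ) * x i =
      voronoiTerm lam P k x := by
  simp [voronoi, voronoiTerm, Fin.sum_univ_two]
  ring

theorem voronoi_gap (hP : Function.Injective P)
    (hlam : ∀ k l, 2 * (v l - v k + 1) ≤ lam) (k l : Fin (N + 1)) {x : Fin 2 → ℝ} (hkl : l ≠ k)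
    (h0 : |x 0 - (P k).1| ≤ 1 / 4) (h1 : |x 1 - (P k).2| ≤ 1 / 4) :
    v l + voronoiTerm lam P l x + 1 ≤ v k + voronoiTerm lam P k x ∧
      voronoiTerm lam P l x + 1 ≤ voronoiTerm lam P k x := by
  have hnn : 2 ≤ lam := by simpa using hlam k k
  have hnn' : (2 : ℝ) ≤ lam := by exact_mod_cast hnn
  have h := voronoiTerm_le (by omega : 0 ≤ lam) k l h0 h1
  have hd := one_le_sqDist hP hkl
  have hv : 2 * ((v l : ℝ) - v k + 1) ≤ lam := by exact_mod_cast hlam k l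
  constructor <;> nlinarith

theorem voronoi_eval_eq (hP : Function.Injective P)
    (hlam : ∀ k l, 2 * (v l - v k + 1) ≤ lam) (k : Fin (N + 1)) {x : Fin 2 → ℝ}
    (h0 : |x 0 - (P k).1| ≤ 1 / 4) (h1 : |x 1 - (P k).2| ≤ 1 / 4) :
    (voronoi lam P v).eval x = v k := by
  have hnum : (Finset.univ.sup' Finset.univ_nonempty fun k =>
      (voronoi lam P v).α k + ∑ i, (((voronoi lam P v).a k i : ℚ) : ℝ) * x i) =
      v k + voronoiTerm lam P k x := by
    apply le_antisymm
    · refine Finset.sup'_le _ _ fun (l : Fin (N + 1)) _ => (voronoi_num l x).trans_le ?_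
      by_cases hkl : l = k
      · rw [hkl]
      · linarith [(voronoi_gap hP hlam k l hkl h0 h1).1]
    · rw [← voronoi_num]
      exact Finset.le_sup' (fun k => (voronoi lam P v).α k +
        ∑ i, (((voronoi lam P v).a k i : ℚ) : ℝ) * x i) (Finset.mem_univ k)
  have hden : (Finset.univ.sup' Finset.univ_nonempty fun k =>
      (voronoi lam P v).β k + ∑ i, (((voronoi lam P v).b k i : ℚ) : ℝ) * x i) =
      voronoiTerm lam P k x := by
    apply le_antisymm
    · refine Finset.sup'_le _ _ fun (l : Fin (N + 1)) _ => (voronoi_den l x).trans_le ?_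
      by_cases hkl : l = k
      · rw [hkl]
      · linarith [(voronoi_gap hP hlam k l hkl h0 h1).2]
    · rw [← voronoi_den (v := v)]
      exact Finset.le_sup' (fun k => (voronoi lam P v).β k +
        ∑ i, (((voronoi lam P v).b k i : ℚ) : ℝ) * x i) (Finset.mem_univ k)
  unfold RelMaxPlus.eval
  rw [hnum, hden]
  ring

theorem voronoi_relElem {t : ℝ} (ht : 0 < t) (x : Fin 2 → ℝ) :
    (voronoi lam P v).relElem t (fun i => t ^ x i) =
      (∑ k, t ^ (v k + voronoiTerm lam P k x)) / ∑ k, t ^ voronoiTerm lam P k x := by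
  have hnum : ∀ k : Fin (N + 1), t ^ (voronoi lam P v).α k *
      ∏ i, (t ^ x i) ^ (((voronoi lam P v).a k i : ℚ) : ℝ) = t ^ (v k + voronoiTerm lam P k x) := by
    intro k
    rw [← voronoi_num, Real.rpow_add ht, Real.rpow_sum_of_pos ht]
    congr 1
    refine Finset.prod_congr rfl fun i _ => ?_
    rw [mul_comm, Real.rpow_mul ht.le]
  have hden : ∀ k : Fin (N + 1), t ^ (voronoi lam P v).β k *
      ∏ i, (t ^ x i) ^ (((voronoi lam P v).b k i : ℚ) : ℝ) = t ^ voronoiTerm lam P k x := by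
    intro k
    rw [← voronoi_den (v := v), Real.rpow_add ht, Real.rpow_sum_of_pos ht]
    congr 1
    refine Finset.prod_congr rfl fun i _ => ?_
    rw [mul_comm, Real.rpow_mul ht.le]
  exact congrArg₂ (· / ·) (Finset.sum_congr rfl fun k _ => hnum k)
    (Finset.sum_congr rfl fun k _ => hden k)

/-- A sum of powers of `t` in which the exponent `e k` exceeds the others by `1`. -/
theorem rpow_le_sum_le {t : ℝ} (ht : 1 ≤ t) (e : Fin (N + 1) → ℝ) (k : Fin (N + 1))
    (h : ∀ l, l ≠ k → e l + 1 ≤ e k) :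
    t ^ e k ≤ ∑ l, t ^ e l ∧ ∑ l, t ^ e l ≤ (1 + N / t) * t ^ e k := by
  have ht0 : 0 < t := by linarith
  constructor
  · exact Finset.single_le_sum (f := fun l => t ^ e l) (fun l _ => (Real.rpow_pos_of_pos ht0 _).le)
      (Finset.mem_univ k)
  · rw [← Finset.add_sum_erase _ _ (Finset.mem_univ k)]
    have : ∑ l ∈ Finset.univ.erase k, t ^ e l ≤ ∑ l ∈ Finset.univ.erase k, t ^ e k / t := by
      refine Finset.sum_le_sum fun l hl => ?_
      rw [← Real.rpow_sub_one ht0.ne']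
      exact Real.rpow_le_rpow_of_exponent_le ht
        (by linarith [h l (Finset.ne_of_mem_erase hl)])
    simp only [Finset.sum_const, Finset.card_erase_of_mem (Finset.mem_univ k), Finset.card_univ,
      Fintype.card_fin, Nat.add_sub_cancel, nsmul_eq_mul] at this
    calc _ ≤ _ := add_le_add_right this _
      _ = _ := by ring

/-- The relatively elementary function that corresponds to `voronoi lam P v` maps a neighbourhood
of `t ^ P k` given by a bounded factor `B` to a neighbourhood of `t ^ v k` given by a factor `D`
close to `1`, for large `t`. -/
theorem exists_voronoi_relElem_mem (hP : Function.Injective P)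
    (hlam : ∀ k l, 2 * (v l - v k + 1) ≤ lam) (B D : ℝ) (hB : 1 ≤ B) (hD : 1 < D) :
    ∀ᶠ t : ℝ in atTop, ∀ (k : Fin (N + 1)) (z : Fin 2 → ℝ),
      (B⁻¹ * t ^ (P k).1 ≤ z 0 ∧ z 0 ≤ B * t ^ (P k).1) →
      (B⁻¹ * t ^ (P k).2 ≤ z 1 ∧ z 1 ≤ B * t ^ (P k).2) →
      D⁻¹ * t ^ v k ≤ (voronoi lam P v).relElem t z ∧
        (voronoi lam P v).relElem t z ≤ D * t ^ v k := by
  have hB0 : 0 < B := by linarith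
  have hD0 : 0 < D := by linarith
  have hN : ∀ᶠ t : ℝ in atTop, N / (D - 1) ≤ t := eventually_ge_atTop _
  filter_upwards [hN, eventually_gt_atTop 1, eventually_ge_atTop (B ^ (4 : ℕ))] with t htN ht1 htB
  intro k z hz0 hz1
  have ht0 : 0 < t := by linarith
  have hND : 1 + N / t ≤ D := by
    have : N / t ≤ D - 1 := by
      rw [div_le_iff₀ ht0]
      rwa [div_le_iff₀ (by linarith), mul_comm] at htN
    linarith
  have hlogt : 0 < Real.log t := Real.log_pos ht1
  have hlogB : Real.log B ≤ 1 / 4 * Real.log t := by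
    have := Real.log_le_log (by positivity) htB
    rw [Real.log_pow] at this
    push_cast at this
    linarith
  -- a factor of at most `B` in `y` is a difference of at most `1 / 4` in the logarithm to base `t`
  have key : ∀ (y : ℝ) (n : ℤ), (B⁻¹ * t ^ n ≤ y ∧ y ≤ B * t ^ n) →
      0 < y ∧ |Real.log y / Real.log t - n| ≤ 1 / 4 := by
    rintro y n ⟨h1, h2⟩
    have hp : 0 < t ^ n := zpow_pos ht0 n
    have hy : 0 < y := lt_of_lt_of_le (by positivity) h1
    refine ⟨hy, ?_⟩
    have l1 := Real.log_le_log (by positivity) h1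
    have l2 := Real.log_le_log hy h2
    rw [Real.log_mul (by positivity) hp.ne', Real.log_inv, Real.log_zpow] at l1
    rw [Real.log_mul (by positivity) hp.ne', Real.log_zpow] at l2
    have : Real.log y / Real.log t - n = (Real.log y - n * Real.log t) / Real.log t := by
      field_simp
    rw [this, abs_div, abs_of_pos hlogt, div_le_iff₀ hlogt, abs_le]
    constructor <;> linarith
  obtain ⟨hp0, hx0⟩ := key _ _ hz0
  obtain ⟨hp1, hx1⟩ := key _ _ hz1
  set x : Fin 2 → ℝ := fun i => Real.log (z i) / Real.log t with hx
  have hz : z = fun i => t ^ x i := by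
    funext i
    have hi : 0 < z i := by fin_cases i <;> assumption
    rw [hx, Real.rpow_def_of_pos ht0]
    simp only
    rw [mul_div_cancel₀ _ hlogt.ne', Real.exp_log hi]
  obtain ⟨n1, n2⟩ := rpow_le_sum_le ht1.le (fun l => (v l : ℝ) + voronoiTerm lam P l x) k
    fun l hl => (voronoi_gap hP hlam k l hl hx0 hx1).1
  obtain ⟨d1, d2⟩ := rpow_le_sum_le ht1.le (fun l => voronoiTerm lam P l x) k
    fun l hl => (voronoi_gap hP hlam k l hl hx0 hx1).2
  rw [hz, voronoi_relElem ht0]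
  have hT : 0 < t ^ voronoiTerm lam P k x := Real.rpow_pos_of_pos ht0 _
  have hV : 0 < t ^ v k := zpow_pos ht0 _
  rw [Real.rpow_add ht0, Real.rpow_intCast] at n1 n2
  have hden : 0 < ∑ l, t ^ voronoiTerm lam P l x := lt_of_lt_of_le hT d1
  constructor
  · rw [le_div_iff₀ hden]
    calc D⁻¹ * t ^ v k * ∑ l, t ^ voronoiTerm lam P l x
        ≤ D⁻¹ * t ^ v k * (D * t ^ voronoiTerm lam P k x) := by
          have := d2.trans (mul_le_mul_of_nonneg_right hND hT.le)
          gcongr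
      _ = t ^ v k * t ^ voronoiTerm lam P k x := by field_simp
      _ ≤ _ := n1
  · rw [div_le_iff₀ hden]
    calc _ ≤ (1 + N / t) * (t ^ v k * t ^ voronoiTerm lam P k x) := n2
      _ ≤ D * (t ^ v k * t ^ voronoiTerm lam P k x) :=
          mul_le_mul_of_nonneg_right hND (by positivity)
      _ = D * t ^ v k * t ^ voronoiTerm lam P k x := by ring
      _ ≤ _ := by gcongr

end voronoi

/-! ### Products along periodic sequences -/

theorem dvd_of_isLeast_periodic {X : Type*} {x : ℕ → X} {m n : ℕ}
    (h : IsLeast {n | 0 < n ∧ Function.Periodic x n} m) (hn : Function.Periodic x n) : m ∣ n := by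
  obtain ⟨⟨hm, hper⟩, hmin⟩ := h
  by_contra hnd
  have hr : 0 < n % m := Nat.pos_of_ne_zero fun h => hnd (Nat.dvd_of_mod_eq_zero h)
  refine absurd (hmin ⟨hr, fun j => ?_⟩) (not_le.mpr (Nat.mod_lt n hm))
  have h1 := hper.nat_mul (n / m) (j + n % m)
  rw [← h1, add_assoc, Nat.cast_id, mul_comm, Nat.mod_add_div]
  exact hn j

section seqProd

variable {G : Type*} [Group G]

/-- The product `x_{j-1} ⋯ x₁ x₀`. -/
def seqProd (x : ℕ → G) : ℕ → G
  | 0 => 1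
  | j + 1 => x j * seqProd x j

theorem seqProd_congr {x y : ℕ → G} (n : ℕ) (h : ∀ j < n, x j = y j) :
    seqProd x n = seqProd y n := by
  induction n with
  | zero => rfl
  | succ n ih =>
    rw [seqProd, seqProd, h n (by omega), ih fun j hj => h j (by omega)]

theorem seqProd_add_period {x : ℕ → G} {m : ℕ} (h : Function.Periodic x m) (j : ℕ) :
    seqProd x (j + m) = seqProd x j * seqProd x m := by
  induction j with
  | zero => simp [seqProd]
  | succ j ih => rw [Nat.add_right_comm, seqProd, seqProd, ih, h j, mul_assoc]

theorem seqProd_add_mul {x : ℕ → G} {m : ℕ} (h : Function.Periodic x m) (j l : ℕ) :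
    seqProd x (j + m * l) = seqProd x j * seqProd x m ^ l := by
  induction l with
  | zero => simp
  | succ l ih =>
    rw [Nat.mul_succ, ← add_assoc, seqProd_add_period h, ih, pow_succ, mul_assoc]

theorem seqProd_add_orderOf {x : ℕ → G} {m : ℕ} (h : Function.Periodic x m) (j l : ℕ) :
    seqProd x (j + m * orderOf (seqProd x m) * l) = seqProd x j := by
  rw [mul_assoc, seqProd_add_mul h, pow_mul, pow_orderOf_eq_one, one_pow, mul_one]

/-- If the products never change after a shift by `r`, then `r` is a period. -/
theorem periodic_of_seqProd_add {x : ℕ → G} {r : ℕ}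
    (h : ∀ j, seqProd x (j + r) = seqProd x j) : Function.Periodic x r := by
  intro j
  have h1 := h (j + 1)
  rw [Nat.add_right_comm, seqProd, seqProd, h j] at h1
  exact mul_right_cancel h1

theorem exists_seqProd_eq {s : Set G} {g : G} (hg : g ∈ Submonoid.closure s) (hs : s.Nonempty) :
    ∃ (x : ℕ → G) (n : ℕ), (∀ j, x j ∈ s) ∧ seqProd x n = g := by
  classical
  induction hg using Submonoid.closure_induction_left with
  | one => exact ⟨fun _ => hs.some, 0, fun _ => hs.some_mem, rfl⟩
  | mul_left y hy g _ ih =>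
    obtain ⟨x, n, hx, rfl⟩ := ih
    refine ⟨Function.update x n y, n + 1, fun j => ?_, ?_⟩
    · by_cases hj : j = n
      · subst hj; simpa using hy
      · simpa [hj] using hx j
    · rw [seqProd, Function.update_self]
      congr 1
      exact seqProd_congr n fun j hj => by simp [hj.ne]

/-- If the generators have finite order, then every nontrivial element of the group is a product of
generators along a period of a periodic sequence. The least period may be shorter, and then the
element is a power of the product along the least period. -/
theorem exists_leastPeriod_dvd_orderOf {s : Set G} {g : G} (hg : g ∈ Subgroup.closure s)
    (hs : s.Nonempty) (htors : ∀ g ∈ s, IsOfFinOrder g) (hne : g ≠ 1) :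
    ∃ (x : ℕ → G) (m : ℕ), (∀ j, x j ∈ s) ∧
      IsLeast {n | 0 < n ∧ Function.Periodic x n} m ∧ orderOf g ∣ orderOf (seqProd x m) := by
  have hg' : g ∈ Submonoid.closure s := by
    induction hg using Subgroup.closure_induction_left with
    | one => exact absurd rfl hne
    | mul_left y hy g _ ih =>
      by_cases h : g = 1
      · rw [h, mul_one]; exact Submonoid.subset_closure hy
      · exact mul_mem (Submonoid.subset_closure hy) (ih h)
    | inv_mul_cancel y hy g _ ih =>
      have hinv : y⁻¹ ∈ Submonoid.closure s := by
        obtain ⟨n, hn, hn1⟩ := (isOfFinOrder_iff_pow_eq_one.mp (htors y hy))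
        have : y⁻¹ = y ^ (n - 1) := by
          rw [inv_eq_iff_mul_eq_one, ← pow_succ', Nat.sub_add_cancel hn, hn1]
        rw [this]
        exact pow_mem (Submonoid.subset_closure hy) _
      by_cases h : g = 1
      · rw [h, mul_one]; exact hinv
      · exact mul_mem hinv (ih h)
  obtain ⟨x, n, hx, hxn⟩ := exists_seqProd_eq hg' hs
  have hn : 0 < n := by
    rcases Nat.eq_zero_or_pos n with rfl | h
    · exact absurd hxn.symm hne
    · exact h
  classical
  set y : ℕ → G := fun j => x (j % n) with hy
  have hper : ∃ k, 0 < k ∧ Function.Periodic y k := ⟨n, hn, fun j => by simp [hy]⟩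
  have hyn : seqProd y n = g := by
    rw [← hxn]
    exact seqProd_congr n fun j hj => by simp [hy, Nat.mod_eq_of_lt hj]
  have hleast : IsLeast {n | 0 < n ∧ Function.Periodic y n} (Nat.find hper) :=
    ⟨Nat.find_spec hper, fun k hk => Nat.find_min' hper hk⟩
  refine ⟨y, Nat.find hper, fun j => hx _, hleast, ?_⟩
  obtain ⟨l, hl⟩ := dvd_of_isLeast_periodic hleast (n := n) fun j => by simp [hy]
  have h := seqProd_add_mul hleast.1.2 0 l
  rw [zero_add, ← hl, hyn, seqProd, one_mul] at h
  rw [h]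
  exact orderOf_pow_dvd l

end seqProd

/-! ### Solutions near the lattice -/

/-- The real number `y` equals `t ^ n` up to a factor of at most `A`. -/
def IsNear (A t : ℝ) (n : ℤ) (y : ℝ) : Prop := A⁻¹ * t ^ n ≤ y ∧ y ≤ A * t ^ n

namespace IsNear

variable {A B t y y' : ℝ} {n n' : ℤ}

theorem mono (ht : 0 < t) (hA : 0 < A) (h : IsNear A t n y) (hAB : A ≤ B) : IsNear B t n y := by
  have : 0 < t ^ n := zpow_pos ht n
  refine ⟨le_trans ?_ h.1, h.2.trans ?_⟩
  · gcongr
  · gcongr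

theorem self (ht : 0 < t) (hA : 1 ≤ A) : IsNear A t n (t ^ n) := by
  have : 0 < t ^ n := zpow_pos ht n
  exact ⟨mul_le_of_le_one_left this.le (inv_le_one_of_one_le₀ hA), le_mul_of_one_le_left this.le hA⟩

theorem pos (ht : 0 < t) (hA : 0 < A) (h : IsNear A t n y) : 0 < y :=
  lt_of_lt_of_le (mul_pos (inv_pos.mpr hA) (zpow_pos ht n)) h.1

theorem ratioPM_le (ht : 0 < t) (hA : 0 < A) (hB : 0 < B) (h : IsNear A t n y)
    (h' : IsNear B t n y') : ratioPM y y' ≤ A * B := by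
  have hp : 0 < t ^ n := zpow_pos ht n
  refine max_le ?_ ?_
  · rw [div_le_iff₀ (h'.pos ht hB)]
    calc y ≤ A * t ^ n := h.2
      _ = A * B * (B⁻¹ * t ^ n) := by field_simp
      _ ≤ _ := by gcongr; exact h'.1
  · rw [div_le_iff₀ (h.pos ht hA)]
    calc y' ≤ B * t ^ n := h'.2
      _ = A * B * (A⁻¹ * t ^ n) := by field_simp
      _ ≤ _ := by gcongr; exact h.1

theorem le_div (ht : 1 < t) (hB : 0 < B) (h : IsNear B t n y) (h' : IsNear B t n' y')
    (hn : n' < n) : t / B ^ 2 ≤ y / y' := by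
  have ht0 : 0 < t := by linarith
  have hp : 0 < t ^ n' := zpow_pos ht0 n'
  rw [le_div_iff₀ (h'.pos ht0 hB)]
  calc t / B ^ 2 * y' ≤ t / B ^ 2 * (B * t ^ n') := by gcongr; exact h'.2
    _ = B⁻¹ * t ^ (n' + 1) := by rw [zpow_add_one₀ ht0.ne']; field_simp
    _ ≤ B⁻¹ * t ^ n := by gcongr; exacts [ht.le, hn]
    _ ≤ y := h.1

theorem le_ratioPM (ht : 1 < t) (hB : 0 < B) (h : IsNear B t n y) (h' : IsNear B t n' y')
    (hn : n ≠ n') : t / B ^ 2 ≤ ratioPM y y' := by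
  rcases lt_or_gt_of_ne hn with h1 | h1
  · exact (h'.le_div ht hB h h1).trans (le_max_right _ _)
  · exact (h.le_div ht hB h' h1).trans (le_max_left _ _)

end IsNear

theorem exists_isStateSolution (f g : (Fin 2 → ℝ) → ℝ) (z₀ w₀ : ℕ → ℝ) :
    ∃ z w : ℕ → ℕ → ℝ, IsStateSolution (α := 0) (β := 0) f g z w ∧ (fun i => z i 0) = z₀ ∧
      w 0 = w₀ := by
  let row : ℝ → (ℕ → ℝ) → ℕ → ℝ := fun y z i =>
    Nat.rec y (fun i w => g (Fin.cons w fun k : Fin 1 => z (i + k))) i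
  let zz : ℕ → ℕ → ℝ := fun j => Nat.rec z₀
    (fun j z i => f (Fin.cons (row (w₀ j) z i) fun k : Fin 1 => z (i + k))) j
  exact ⟨fun i j => zz j i, fun i j => row (w₀ j) (zz j) i,
    ⟨fun _ _ => rfl, fun _ _ => rfl⟩, rfl, rfl⟩

section dynamics

variable {Q S : Type} {M : MealyAutomaton Q S} {eQ : Q → ℤ} {eS : S → ℤ}
  {perm : Q → Equiv.Perm (ℕ → S)} {f g : (Fin 2 → ℝ) → ℝ} {A B D t : ℝ}

/-- The maps `f` and `g` contract the neighbourhoods of the lattice points `t ^ (q, s)` that are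
given by the factor `B` to neighbourhoods given by the factor `D`, and act on the exponents as the
automaton. -/
structure Contracts (M : MealyAutomaton Q S) (eQ : Q → ℤ) (eS : S → ℤ) (f g : (Fin 2 → ℝ) → ℝ)
    (B D t : ℝ) : Prop where
  out : ∀ q s x, IsNear B t (eQ q) (x 0) → IsNear B t (eS s) (x 1) →
    IsNear D t (eS (M.out q s)) (f x)
  next : ∀ q s x, IsNear B t (eQ q) (x 0) → IsNear B t (eS s) (x 1) →
    IsNear D t (eQ (M.next q s)) (g x)

/-- If row `j` lies near the lattice, then row `j + 1` lies near its image under the automaton,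
started in the state near `w 0 j`. -/
theorem Contracts.row (hc : Contracts M eQ eS f g B D t) (ht : 0 < t) (hD : 0 < D) (hDB : D ≤ B)
    {z w : ℕ → ℕ → ℝ} (hsol : IsStateSolution (α := 0) (β := 0) f g z w) {q : Q} {k : ℕ → S}
    {j : ℕ} (hz : ∀ i, IsNear B t (eS (k i)) (z i j)) (hw : IsNear B t (eQ q) (w 0 j)) (i : ℕ) :
    IsNear D t (eS (M.act q k i)) (z i (j + 1)) := by
  have hstate : ∀ i, IsNear B t (eQ (M.stateSeq q k i)) (w i j) := by
    intro i
    induction i with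
    | zero => exact hw
    | succ i ih =>
      rw [hsol.2 i j]
      exact (hc.next _ _ _ ih (hz i)).mono ht hD hDB
  rw [hsol.1 i j]
  exact hc.out _ _ _ (hstate i) (hz i)

/-- The solutions follow the action of the automaton. The error does not accumulate: it is given by
the factor `D` after the first step. -/
theorem Contracts.isNear (hperm : ∀ q, ⇑(perm q) = M.act q) (hc : Contracts M eQ eS f g B D t)
    (ht : 0 < t) (hA : 0 < A) (hAB : A ≤ B) (hD : 0 < D) (hDB : D ≤ B)
    {z w : ℕ → ℕ → ℝ} (hsol : IsStateSolution (α := 0) (β := 0) f g z w)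
    {q : ℕ → Q} {k : ℕ → S} (hz : ∀ i, IsNear A t (eS (k i)) (z i 0))
    (hw : ∀ j, IsNear A t (eQ (q j)) (w 0 j)) :
    (∀ j i, IsNear B t (eS (seqProd (fun j => perm (q j)) j k i)) (z i j)) ∧
      ∀ j i, IsNear D t (eS (seqProd (fun j => perm (q j)) (j + 1) k i)) (z i (j + 1)) := by
  have step : ∀ j, (∀ i, IsNear B t (eS (seqProd (fun j => perm (q j)) j k i)) (z i j)) →
      ∀ i, IsNear D t (eS (seqProd (fun j => perm (q j)) (j + 1) k i)) (z i (j + 1)) := by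
    intro j hj i
    rw [seqProd, Equiv.Perm.mul_apply, hperm]
    exact hc.row ht hD hDB hsol hj ((hw j).mono ht hA hAB) i
  have h : ∀ j i, IsNear B t (eS (seqProd (fun j => perm (q j)) j k i)) (z i j) := by
    intro j
    induction j with
    | zero => exact fun i => (hz i).mono ht hA hAB
    | succ j ih => exact fun i => (step j ih i).mono ht hD hDB
  exact ⟨h, fun j => step j (h j)⟩

/-- The quasi-period for input exponents of least period `m` is `m` times the order of the product
of the states along one period. -/
theorem Contracts.isQuasiPeriod {C C' : ℝ} (hperm : ∀ q, ⇑(perm q) = M.act q)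
    (hc : Contracts M eQ eS f g B D t) (ht : 1 < t) (hA : 1 ≤ A) (hAB : A ≤ B) (hD : 1 ≤ D)
    (hDB : D ≤ B) (hDC : D * D ≤ C) (hADC : A * D ≤ C) (hC' : C' ≤ t / B ^ 2)
    (heS : Function.Injective eS) {q : ℕ → Q} {m : ℕ}
    (hq : IsLeast {n | 0 < n ∧ Function.Periodic q n} m)
    (hinj : ∀ i j, perm (q i) = perm (q j) → q i = q j)
    (hfin : IsOfFinOrder (seqProd (fun j => perm (q j)) m)) {w₀ : ℕ → ℝ}
    (hw₀ : ∀ j, IsNear A t (eQ (q j)) (w₀ j)) :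
    IsQuasiPeriod (α := 0) (β := 0) f g (expLattice A t (Set.range eS)) w₀ C C' m
      (m * orderOf (seqProd (fun j => perm (q j)) m)) := by
  set W := seqProd fun j => perm (q j) with hW
  have ht0 : 0 < t := by linarith
  have hA0 : 0 < A := by linarith
  have hB0 : 0 < B := by linarith
  have hD0 : 0 < D := by linarith
  have hm : 0 < m := hq.1.1
  have hper : Function.Periodic (fun j => perm (q j)) m := fun j => congrArg perm (hq.1.2 j)
  have hshift : ∀ j l, W (j + m * orderOf (W m) * l) = W j := seqProd_add_orderOf hper
  have hnear := fun z w hsol k hz hw => hc.isNear hperm ht0 hA0 hAB hD0 hDB (z := z) (w := w)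
    hsol (q := q) (k := k) hz hw
  -- the solution with initial exponents `k`
  have hex : ∀ k : ℕ → S, ∃ z w : ℕ → ℕ → ℝ, IsStateSolution (α := 0) (β := 0) f g z w ∧
      (fun i => z i 0) ∈ expLattice A t (Set.range eS) ∧ w 0 = w₀ ∧
      ∀ j i, IsNear B t (eS (W j k i)) (z i j) := by
    intro k
    obtain ⟨z, w, hsol, hz, hw⟩ := exists_isStateSolution f g (fun i => t ^ eS (k i)) w₀
    have hz' : ∀ i, IsNear A t (eS (k i)) (z i 0) := fun i => by
      rw [congrFun hz i]
      exact .self ht0 hA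
    exact ⟨z, w, hsol, ⟨fun i => eS (k i), fun i => ⟨k i, rfl⟩, hz'⟩, hw,
      (hnear z w hsol k hz' fun j => hw ▸ hw₀ j).1⟩
  have hsep : ∀ {x y : S} {y₁ y₂ : ℝ}, IsNear B t (eS x) y₁ → IsNear B t (eS y) y₂ → x ≠ y →
      C' ≤ ratioPM y₁ y₂ := fun h1 h2 hne =>
    hC'.trans (h1.le_ratioPM ht hB0 h2 fun h => hne (heS h))
  have hdvd : ∀ p', 0 < p' → p' < m * orderOf (W m) → m ∣ p' →
      ∃ k, ∀ j, ∃ i, W (j + p') k i ≠ W j k i := by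
    rintro _ hp0 hp ⟨r, rfl⟩
    have hr : W m ^ r ≠ 1 := pow_ne_one_of_lt_orderOf (by rintro rfl; simp at hp0)
      (lt_of_mul_lt_mul_left hp hm.le)
    obtain ⟨k, hk⟩ : ∃ k, (W m ^ r) k ≠ k := by
      by_contra! h
      exact hr (Equiv.ext h)
    refine ⟨k, fun j => Function.ne_iff.mp ?_⟩
    rw [hW, seqProd_add_mul hper, Equiv.Perm.mul_apply]
    exact fun h => hk ((seqProd (fun j => perm (q j)) j).injective h)
  refine ⟨Nat.mul_pos hm hfin.orderOf_pos, dvd_mul_right _ _, ?_, ?_, ?_⟩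
  · rintro z w hsol ⟨e, he, hz⟩ rfl i j l
    choose k hk using he
    obtain ⟨h1, h2⟩ := hnear z w hsol k (fun i => hk i ▸ hz i) hw₀
    rcases Nat.eq_zero_or_pos (m * orderOf (W m) * l) with h0 | h0
    · have hy := (h1 j i).pos ht0 hB0
      rw [h0, add_zero, ratioPM, div_self hy.ne', max_self]
      nlinarith
    · obtain ⟨n, hn⟩ : ∃ n, j + m * orderOf (W m) * l = n + 1 :=
        ⟨j + m * orderOf (W m) * l - 1, by omega⟩
      have hl := h2 n i
      rw [← hn, ← hW, hshift] at hl
      rcases j with _ | j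
      · exact (hl.ratioPM_le ht0 hD0 hA0 (hk i ▸ hz i)).trans (by rwa [mul_comm])
      · exact (hl.ratioPM_le ht0 hD0 hD0 (h2 j i)).trans hDC
  · intro p' hp0 hp
    obtain ⟨j, k, i, hne⟩ : ∃ j k i, W (j + p') k i ≠ W j k i := by
      by_cases hd : m ∣ p'
      · obtain ⟨k, hk⟩ := hdvd p' hp0 hp hd
        exact ⟨0, k, hk 0⟩
      · -- otherwise `p'` would be a period of the input
        by_contra! h
        refine hd (dvd_of_isLeast_periodic hq fun j => hinj _ _ ?_)
        exact periodic_of_seqProd_add (x := fun j => perm (q j)) (r := p')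
          (fun j => Equiv.ext fun k => funext fun i => h j k i) j
    obtain ⟨z, w, hsol, hz, hw, hzn⟩ := hex k
    refine ⟨z, w, hsol, hz, hw, i, j, fun l => hsep (hzn _ _) (hzn _ _) ?_⟩
    rw [Nat.add_right_comm, hshift, hshift]
    exact hne
  · intro p' hp0 hp hd
    obtain ⟨k, hk⟩ := hdvd p' hp0 hp hd
    obtain ⟨z, w, hsol, hz, hw, hzn⟩ := hex k
    refine ⟨z, w, hsol, hz, hw, fun j => ?_⟩
    obtain ⟨i, hi⟩ := hk j
    exact ⟨i, hsep (hzn _ _) (hzn _ _) hi⟩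

end dynamics

/-! ### The stable extension -/

/-- The point of the lattice that is given by a pair of a state and a letter. -/
def latticePoint (eQ : Fin 8 → ℤ) (eS : Fin 2 → ℤ) (n : Fin (15 + 1)) : ℤ × ℤ :=
  (eQ ((finProdFinEquiv (m := 8) (n := 2)).symm n).1,
    eS ((finProdFinEquiv (m := 8) (n := 2)).symm n).2)

theorem latticePoint_injective {eQ : Fin 8 → ℤ} {eS : Fin 2 → ℤ} (hQ : Function.Injective eQ)
    (hS : Function.Injective eS) : Function.Injective (latticePoint eQ eS) := by
  intro k l h
  apply (finProdFinEquiv (m := 8) (n := 2)).symm.injective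
  exact Prod.ext (hQ (congrArg Prod.fst h)) (hS (congrArg Prod.snd h))

/-- A relative `(max,+)`-function that takes prescribed integral values at the lattice points, is
constant near each of them, and of which the relatively elementary function contracts
neighbourhoods of the lattice points. -/
theorem exists_relMaxPlus {eQ : Fin 8 → ℤ} {eS : Fin 2 → ℤ} (hQ : Function.Injective eQ)
    (hS : Function.Injective eS) (v : Fin 8 → Fin 2 → ℤ) :
    ∃ φ : RelMaxPlus 2, (∀ q s, φ.eval ![(eQ q : ℝ), (eS s : ℝ)] = v q s) ∧
      IsStable (n := 1) (Set.range fun q => (eQ q : ℝ)) (Set.range fun s => (eS s : ℝ)) φ.eval ∧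
      ∀ B D : ℝ, 1 ≤ B → 1 < D → ∀ᶠ t : ℝ in atTop, ∀ q s (x : Fin 2 → ℝ),
        IsNear B t (eQ q) (x 0) → IsNear B t (eS s) (x 1) →
          IsNear D t (v q s) (φ.relElem t x) := by
  set P := latticePoint eQ eS with hPdef
  have hP : Function.Injective P := latticePoint_injective hQ hS
  set V : Fin (15 + 1) → ℤ := fun n => v ((finProdFinEquiv (m := 8) (n := 2)).symm n).1
    ((finProdFinEquiv (m := 8) (n := 2)).symm n).2 with hV
  obtain ⟨lam, hlam⟩ := (Set.finite_range fun kl : Fin (15 + 1) × Fin (15 + 1) =>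
    2 * (V kl.2 - V kl.1 + 1)).bddAbove
  have hlam' : ∀ k l, 2 * (V l - V k + 1) ≤ lam := fun k l => hlam ⟨(k, l), rfl⟩
  have hpt : ∀ q s, ∃ k, P k = (eQ q, eS s) ∧ V k = v q s := fun q s =>
    ⟨finProdFinEquiv (m := 8) (n := 2) (q, s), by
      simp only [hPdef, latticePoint, hV]
      erw [Equiv.symm_apply_apply]
      exact ⟨rfl, rfl⟩⟩
  have heval : ∀ q s (x : Fin 2 → ℝ), |x 0 - eQ q| ≤ 1 / 4 → |x 1 - eS s| ≤ 1 / 4 →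
      (voronoi lam P V).eval x = v q s := by
    intro q s x h0 h1
    obtain ⟨k, hk, hk'⟩ := hpt q s
    rw [← hk']
    exact voronoi_eval_eq hP hlam' k (by rwa [hk]) (by rwa [hk])
  refine ⟨voronoi lam P V, fun q s => heval q s _ (by simp) (by simp), ?_, ?_⟩
  · refine ⟨1 / 4, 0, by norm_num, by norm_num, le_rfl, one_pos, ?_⟩
    rintro x p ⟨q, hq⟩ hs hdist
    obtain ⟨s, hs⟩ := hs 0
    simp only at hq hs
    have hx : ∀ i : Fin 2, |x i - p i| ≤ 1 / 4 := fun i => by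
      rw [← Real.dist_eq]
      exact (dist_le_pi_dist x p i).trans hdist.le
    rw [heval q s x (by rw [hq]; exact hx 0) (by rw [hs]; exact hx 1),
      heval q s p (by rw [hq]; simp) (by rw [hs]; simp)]
    simp
  · intro B D hB hD
    filter_upwards [exists_voronoi_relElem_mem hP hlam' B D hB hD] with t ht q s x h0 h1
    obtain ⟨k, hk, hk'⟩ := hpt q s
    rw [← hk']
    exact ht k x (by rw [hk]; exact h0) (by rw [hk]; exact h1)

theorem generatesInfiniteTorsionGroup :
    burnsideAutomaton.GeneratesInfiniteTorsionGroup 5 7 := by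
  refine ⟨Grigorchuk.u, Grigorchuk.v, rfl, rfl, ?_, ?_⟩
  · by_contra hfin
    rw [not_infinite_iff_finite] at hfin
    obtain ⟨g, hg, hlt⟩ := Grigorchuk.exists_lt_orderOf
      (Nat.card (Subgroup.closure {Grigorchuk.u, Grigorchuk.v}))
    have h := orderOf_le_card (x := (⟨g, hg⟩ : Subgroup.closure {Grigorchuk.u, Grigorchuk.v}))
    rw [Subgroup.orderOf_mk] at h
    omega
  · rintro ⟨g, hg⟩
    obtain ⟨n, hn⟩ := Grigorchuk.isTwoTorsion_of_mem_closure hg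
    exact isOfFinOrder_iff_pow_eq_one.mpr ⟨2 ^ n, by positivity, Subtype.ext hn⟩

/-- If the maps of the state system contract neighbourhoods of the lattice points as strongly as one
likes for large `t`, then the state system has a quasi-period `p` for every input, and the
quotients `p / m` are orders of elements of the group generated by `u` and `v`. -/
theorem infinitelyQuasiRecursive_of_contracts {eQ : Fin 8 → ℤ} {eS : Fin 2 → ℤ}
    (hQ : Function.Injective eQ) (hS : Function.Injective eS) {f g : ℝ → (Fin 2 → ℝ) → ℝ}
    (hc : ∀ B D : ℝ, 1 ≤ B → 1 < D → ∀ᶠ t in atTop,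
      Contracts burnsideAutomaton eQ eS (f t) (g t) B D t) :
    InfinitelyQuasiRecursive (α := 0) (β := 0) f g (Set.range eS) {eQ 5, eQ 7} := by
  intro A C C' hA hAC _
  -- the constant `D` has to satisfy `D² ≤ C` and `A D ≤ C`
  have hCA : 1 < C / A := by rwa [one_lt_div (by linarith)]
  set D := min 2 (√(C / A)) with hDdef
  have hD1 : 1 < D := lt_min one_lt_two (by rwa [Real.lt_sqrt zero_le_one, one_pow])
  have hDD : D * D ≤ C / A := by
    calc D * D ≤ √(C / A) * √(C / A) := by gcongr <;> exact min_le_right _ _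
      _ = C / A := Real.mul_self_sqrt (by linarith)
  have hD2 : D * D ≤ C := hDD.trans (div_le_self (by linarith) hA)
  have hAD : A * D ≤ C := by
    have : D ≤ C / A := by nlinarith
    rwa [le_div_iff₀ (by linarith), mul_comm] at this
  have hDB : D ≤ 2 * A := (min_le_left _ _).trans (by linarith)
  obtain ⟨t₁, ht₁⟩ := eventually_atTop.mp ((hc (2 * A) D (by linarith) hD1).and
    (eventually_ge_atTop (C' * (2 * A) ^ 2)))
  refine ⟨max t₁ 2, lt_max_of_lt_right one_lt_two, fun t ht => ?_⟩
  obtain ⟨hct, htC⟩ := ht₁ t ((le_max_left _ _).trans ht)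
  have ht1 : 1 < t := lt_of_lt_of_le one_lt_two ((le_max_right _ _).trans ht)
  have hperm57 : perm 5 ≠ perm 7 := Grigorchuk.u_ne_v
  have hmem : ∀ {q : ℕ → Fin 8}, (∀ j, q j = 5 ∨ q j = 7) → ∀ n,
      seqProd (fun j => perm (q j)) n ∈ Subgroup.closure {Grigorchuk.u, Grigorchuk.v} := by
    intro q hq n
    induction n with
    | zero => exact one_mem _
    | succ n ih =>
      refine mul_mem (Subgroup.subset_closure ?_) ih
      rcases hq n with h | h
      exacts [.inl (congrArg perm h), .inr (congrArg perm h)]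
  have hfin : ∀ {x}, x ∈ Subgroup.closure {Grigorchuk.u, Grigorchuk.v} → IsOfFinOrder x := by
    intro x hx
    obtain ⟨n, hn⟩ := Grigorchuk.isTwoTorsion_of_mem_closure hx
    exact isOfFinOrder_iff_pow_eq_one.mpr ⟨2 ^ n, by positivity, hn⟩
  have main : ∀ {q : ℕ → Fin 8} {m : ℕ} {w₀ : ℕ → ℝ}, (∀ j, q j = 5 ∨ q j = 7) →
      IsLeast {n | 0 < n ∧ Function.Periodic q n} m → (∀ j, IsNear A t (eQ (q j)) (w₀ j)) →
      IsQuasiPeriod (α := 0) (β := 0) (f t) (g t) (expLattice A t (Set.range eS)) w₀ C C' m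
        (m * orderOf (seqProd (fun j => perm (q j)) m)) := by
    intro q m w₀ hq hm hw
    refine hct.isQuasiPeriod (fun _ => rfl) ht1 hA (by linarith) hD1.le hDB hD2 hAD
      (by rwa [le_div_iff₀ (by positivity)]) hS hm ?_ (hfin (hmem hq m)) hw
    intro i j h
    rcases hq i with hi | hi <;> rcases hq j with hj | hj <;> rw [hi, hj] at h ⊢
    · exact absurd h hperm57
    · exact absurd h.symm hperm57
  constructor
  · rintro m w₀ ⟨e, he, hm, hw⟩
    have : ∀ j, ∃ q : Fin 8, (q = 5 ∨ q = 7) ∧ eQ q = e j := fun j => by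
      rcases he j with h | h
      exacts [⟨5, .inl rfl, h.symm⟩, ⟨7, .inr rfl, h.symm⟩]
    choose q hq hqe using this
    have hset : {n | 0 < n ∧ Function.Periodic q n} = {n | 0 < n ∧ Function.Periodic e n} := by
      ext n
      refine and_congr_right fun _ => forall_congr' fun j => ?_
      rw [← hqe, ← hqe, hQ.eq_iff]
    exact ⟨_, main hq (hset ▸ hm) fun j => hqe j ▸ hw j⟩
  · refine Set.infinite_of_forall_exists_gt fun N => ?_
    obtain ⟨x, hx, hlt⟩ := Grigorchuk.exists_lt_orderOf (N + 1)
    obtain ⟨y, m, hy, hm, hdvd⟩ := exists_leastPeriod_dvd_orderOf hx ⟨_, .inl rfl⟩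
      (fun z hz => hfin (Subgroup.subset_closure hz)) (by rintro rfl; simp at hlt)
    have : ∀ j, ∃ q : Fin 8, (q = 5 ∨ q = 7) ∧ perm q = y j := fun j => by
      rcases hy j with h | h
      exacts [⟨5, .inl rfl, h.symm⟩, ⟨7, .inr rfl, h.symm⟩]
    choose q hq hqy using this
    have hqy' : (fun j => perm (q j)) = y := funext hqy
    have hset : {n | 0 < n ∧ Function.Periodic q n} = {n | 0 < n ∧ Function.Periodic y n} := by
      ext n
      refine and_congr_right fun _ => forall_congr' fun j => ?_
      rw [← hqy, ← hqy]
      refine ⟨fun h => congrArg perm h, fun h => ?_⟩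
      rcases hq (j + n) with hi | hi <;> rcases hq j with hj | hj <;> rw [hi, hj] at h ⊢
      · exact absurd h hperm57
      · exact absurd h.symm hperm57
    have hm' : IsLeast {n | 0 < n ∧ Function.Periodic q n} m := hset ▸ hm
    have hw : ∀ j, IsNear A t (eQ (q j)) (t ^ eQ (q j)) := fun j => .self (by linarith) hA
    have hQset : {n | 0 < n ∧ Function.Periodic (fun j => eQ (q j)) n} =
        {n | 0 < n ∧ Function.Periodic q n} := by
      ext n
      exact and_congr_right fun _ => forall_congr' fun j => hQ.eq_iff
    refine ⟨orderOf (seqProd y m), ⟨m, fun j => t ^ eQ (q j), ⟨fun j => eQ (q j), fun j => ?_,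
      hQset ▸ hm', hw⟩, hqy' ▸ main hq hm' hw⟩, ?_⟩
    · rcases hq j with h | h <;> simp [h]
    · have hpos : 0 < orderOf (seqProd y m) := (hfin (hqy' ▸ hmem hq m)).orderOf_pos
      have := Nat.le_of_dvd hpos hdvd
      omega

theorem theorem4p12 :
    ∃ (M : MealyAutomaton (Fin 8) (Fin 2)) (u v : Fin 8),
      M.GeneratesInfiniteTorsionGroup u v ∧
      ∀ (eQ : Fin 8 → ℤ) (eS : Fin 2 → ℤ), Function.Injective eQ → Function.Injective eS →
        ∃ Ψ Φ : RelMaxPlus 2, M.IsStableExtension eQ eS Ψ Φ ∧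
          InfinitelyQuasiRecursive (α := 0) (β := 0) Ψ.relElem Φ.relElem
            (Set.range eS) {eQ u, eQ v} := by
  refine ⟨burnsideAutomaton, 5, 7, generatesInfiniteTorsionGroup, fun eQ eS hQ hS => ?_⟩
  obtain ⟨Ψ, hΨ, hΨs, hΨc⟩ := exists_relMaxPlus hQ hS fun q s => eS (burnsideAutomaton.out q s)
  obtain ⟨Φ, hΦ, hΦs, hΦc⟩ := exists_relMaxPlus hQ hS fun q s => eQ (burnsideAutomaton.next q s)
  refine ⟨Ψ, Φ, ⟨hΨ, hΦ, hΨs, hΦs⟩, infinitelyQuasiRecursive_of_contracts hQ hS ?_⟩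
  intro B D hB hD
  filter_upwards [hΨc B D hB hD, hΦc B D hB hD] with t h1 h2
  exact ⟨h1, h2⟩
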